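/- For a real polynomial $P\not\equiv 0$ of degree at most $n$, let $[\![P]\!]_n=\frac1n\sum_{z\in\mathbb C:\,P(z)=0}\delta_z+\frac{n-\deg P}{n}\,\delta_\infty$ (zeros counted with multiplicity) be its empirical distribution of zeros, a probability measure on $\mathbb C\cup\{\infty\}$. If all complex zeros of $P$ are real and nonpositive, we identify $\infty$ with $-\infty$ and regard $[\![P]\!]_n$ as a probability measure on $[-\infty,0]$. For every $n\in\mathbb N$ let $P_n(x)=\sum_{k=0}^n a_{k:n}x^k$ be a polynomial, not identically zero, of degree at most $n$ with coefficients $a_{k:n}\ge 0$. Suppose that $(P_n)$ has an exponential profile $g:(\underline m,\overline m)\to\mathbb R$, where $(\underline m,\overline m)\subseteq[0,1]$ is a nonempty interval; that is, with the convention $\log 0=-\infty$, $$\lim_{n\to\infty}\frac1n\log a_{\lfloor\alpha n\rfloor:n}=\begin{cases}g(\alpha),&\alpha\in(\underline m,\overline m),\\-\infty,&\alpha\in[0,\underline m)\cup(\overline m,1].\end{cases}$$ Suppose also that, for all sufficiently large $n$, all complex roots of $P_n$ are real and nonpositive. Then the following hold. (a) There is a probability measure $\mu$ on $[-\infty,0]$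 such that $[\![P_n]\!]_n\to\mu$ weakly on $[-\infty,0]$ as $n\to\infty$. (b) Let $G_\mu(t)=\int_{(-\infty,0]}\frac{\mu(dz)}{t-z}$ for $t>0$. The function $t\mapsto tG_\mu(t)$ is a strictly increasing continuous bijection from $(0,\infty)$ onto $(\underline m,\overline m)$, and it is the inverse of $\alpha\mapsto e^{-g'(\alpha)}$, $\alpha\in(\underline m,\overline m)$. This determines $\mu$ uniquely: any probability measure $\mu'$ on $[-\infty,0]$ for which $t\mapsto tG_{\mu'}(t)$, $t>0$, is the inverse of $\alpha\mapsto e^{-g'(\alpha)}$ equals $\mu$. (c) The supremum $M_g:=\sup_{\alpha\in(\underline m,\overline m)}g(\alpha)$ is finite and $\lim_{n\to\infty}\frac1n\log P_n(1)=M_g$. On $(\underline m,\overline m)$ the function $-g+M_g$ is the Legendre transform of $u\mapsto\Psi(e^u)$, where $\Psi(t)=\int_{(-\infty,0]}\log\left(\frac{t-z}{1-z}\right)\mu(dz)$ for $t>0$; that is, $-g(\alpha)+M_g=\sup_{u\in\mathbb R}\left(\alpha u-\Psi(e^u)\right)$ for all $\alpha\in(\underline m,\overline m)$. (d) The function $g$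 is infinitely differentiable and strictly concave on $(\underline m,\overline m)$, and even $\alpha\mapsto g(\alpha)+\alpha\log\alpha$ is strictly concave there. (e) $\mu(\{0\})=\underline m$ and $\mu(\{-\infty\})=1-\overline m$. -/

import Mathlib

noncomputable section

/-- The Riemann sphere `ℂ ∪ {∞}` carries its Borel σ-algebra. -/
instance sphereMeasurableSpace : MeasurableSpace (OnePoint ℂ) := borel (OnePoint ℂ)

instance sphereBorelSpace : BorelSpace (OnePoint ℂ) := ⟨rfl⟩

/-- The compactified half-line `[-∞, 0]`. -/
abbrev NegHalfLine : Type := Set.Iic (0 : EReal)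

/-- The point `-∞` of `[-∞, 0]`. -/
def negInfty : NegHalfLine := ⟨⊥, Set.mem_Iic.2 bot_le⟩

/-- The point `0` of `[-∞, 0]`. -/
def zeroPt : NegHalfLine := ⟨0, Set.mem_Iic.2 le_rfl⟩

/-- The inclusion of `[-∞, 0]` into the Riemann sphere: finite points are sent to themselves,
and `-∞` is identified with `∞`. -/
def toSphere (x : NegHalfLine) : OnePoint ℂ :=
  open Classical in
  if x = negInfty then OnePoint.infty else (((x : EReal).toReal : ℂ) : OnePoint ℂ)

theorem measurable_toSphere : Measurable toSphere := by
  classical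
  unfold toSphere
  refine Measurable.ite (measurableSet_singleton negInfty) measurable_const ?_
  have h1 : Measurable (fun z : ℂ => (z : OnePoint ℂ)) := OnePoint.continuous_coe.measurable
  exact h1.comp (Complex.measurable_ofReal.comp
    (measurable_ereal_toReal.comp measurable_subtype_coe))

/-- The empirical distribution of zeros `⟦P⟧ₙ` of a polynomial `P` of degree at most `n`: each
complex zero, counted with multiplicity, has mass `1 / n`, and the remaining mass
`(n - deg P) / n` sits at `∞`. -/
def empiricalZeros (n : ℕ) (P : Polynomial ℝ) : MeasureTheory.Measure (OnePoint ℂ) :=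
  (n : ENNReal)⁻¹ •
      ((P.aroots ℂ).map fun z : ℂ => MeasureTheory.Measure.dirac (z : OnePoint ℂ)).sum +
    (((n - P.natDegree : ℕ) : ENNReal) / (n : ENNReal)) •
      MeasureTheory.Measure.dirac (OnePoint.infty : OnePoint ℂ)

/-- `(1 / n) log a_{⌊α n⌋ : n}`, where `a_{k : n}` is the coefficient of `x ^ k` in `P n` and
`log 0 = -∞`. -/
def scaledLogCoeff (P : ℕ → Polynomial ℝ) (α : ℝ) (n : ℕ) : EReal :=
  ((1 / (n : ℝ) : ℝ) : EReal) * ENNReal.log (ENNReal.ofReal ((P n).coeff ⌊α * (n : ℝ)⌋₊))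

/-- The polynomials `P n`, of degree at most `n` and with nonnegative coefficients, have the
exponential profile `g` on the nonempty interval `(a, b) ⊆ [0, 1]`. Only the values of `g` on
`(a, b)` matter. -/
structure HasExponentialProfile (P : ℕ → Polynomial ℝ) (a b : ℝ) (g : ℝ → ℝ) : Prop where
  natDegree_le : ∀ n, (P n).natDegree ≤ n
  coeff_nonneg : ∀ n k, 0 ≤ (P n).coeff k
  left_nonneg : 0 ≤ a
  lt : a < b
  right_le_one : b ≤ 1
  tendsto_inside : ∀ α ∈ Set.Ioo a b,
    Filter.Tendsto (scaledLogCoeff P α) Filter.atTop (nhds ((g α : ℝ) : EReal))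
  tendsto_outside : ∀ α ∈ Set.Ico 0 a ∪ Set.Ioc b 1,
    Filter.Tendsto (scaledLogCoeff P α) Filter.atTop (nhds (⊥ : EReal))

/-- All complex zeros of `P` are real and nonpositive. -/
def HasOnlyNonposRoots (P : Polynomial ℝ) : Prop :=
  ∀ z : ℂ, Polynomial.aeval z P = 0 → ∃ x : ℝ, x ≤ 0 ∧ z = (x : ℂ)

/-- The Cauchy transform `G_μ(t) = ∫ μ(dz) / (t - z)` at a real point `t` (used for `t > 0`) of
a measure on `[-∞, 0]`; the integrand vanishes at `z = -∞`, so the integral is over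
`(-∞, 0]`. -/
def cauchyTransform (μ : MeasureTheory.Measure NegHalfLine) (t : ℝ) : ℝ :=
  ∫ z in {negInfty}ᶜ, 1 / (t - (z : EReal).toReal) ∂μ

/-- The normalized logarithmic potential `Ψ(t) = ∫_{(-∞, 0]} log ((t - z) / (1 - z)) μ(dz)`. -/
def logPotential (μ : MeasureTheory.Measure NegHalfLine) (t : ℝ) : ℝ :=
  ∫ z in {negInfty}ᶜ, Real.log ((t - (z : EReal).toReal) / (1 - (z : EReal).toReal)) ∂μ

end

/-!
The proof compares two descriptions of `f u = lim (1 / n) log P n (exp u)`.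

*Through the coefficients.* A polynomial with nonnegative coefficients and only nonpositive roots
has log-concave coefficients (`HasOnlyNonposRoots.logConcaveSeq_coeff`). Hence the profile `g` is
concave, and no coefficient, wherever it sits, can beat `sup g` exponentially
(`LogConcaveProfile.eventually_log_lt`). Applied to the tilted polynomials `P n (exp u * x)`, whose
profile is `g α + α u`, this gives `f u = sup_α (g α + α u)`.

*Through the zeros.* In the bounded coordinate `w = 1 / (1 - z)` on `[-∞, 0]` the quotient
`(t - z) / (1 - z)` is `1 + (t - 1) w`, so its logarithm is a continuous function on the compact
space `[-∞, 0]`, equal to `0` at `-∞`, and its integral against the empirical distribution of zeros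
is exactly `(1 / n) log (P n t / P n 1)`. The latter converges to `f (log t) - f 0`. Probability
measures on `[-∞, 0]` form a compact space, and a measure is determined by its logarithmic
potential `Ψ`, because the derivatives of `Ψ` at `1` are, up to nonzero factors, the moments of `w`
(`eq_of_cauchyMoment_one_eqOn`). This gives the weak convergence, and
`Ψ (exp u) = f u - f 0` for the limit `μ`.

*Consequences.* So `u ↦ Ψ (exp u)` is, up to a constant, the conjugate of the concave function `g`
(`IsConjugatePotential`). It is differentiable with derivative `t G(t)` at `t = exp u`. The
supporting line of `g` at `α` yields a `t` with `t G(t) = α`, so `t G(t)` is not constant; then it is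
strictly increasing with positive derivative and maps `(0, ∞)` bijectively onto `(a, b)`. Equality
in Young's inequality and the inverse function theorem give the smoothness of `g`, the formula
`g' = -log t` at `α = t G(t)`, and the concavity statements. The atoms are the limits of `t G(t)`
at `0` and `∞`.
-/

open MeasureTheory Filter Set Topology

noncomputable section

/-! ### A bounded coordinate on the half-line -/

/-- The coordinate `z ↦ 1 / (1 - z)` on `[-∞, 0]`, with value `0` at `-∞`. It is a homeomorphism
onto `[0, 1]`. -/
def cayley (z : NegHalfLine) : ℝ :=
  open Classical in if z = negInfty then 0 else 1 / (1 - (z : EReal).toReal)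

theorem cayley_negInfty : cayley negInfty = 0 := by simp [cayley]

theorem NegHalfLine.toReal_nonpos (z : NegHalfLine) : (z : EReal).toReal ≤ 0 :=
  EReal.toReal_nonpos z.2

theorem cayley_of_ne {z : NegHalfLine} (hz : z ≠ negInfty) :
    cayley z = 1 / (1 - (z : EReal).toReal) := by simp [cayley, hz]

theorem cayley_pos {z : NegHalfLine} (hz : z ≠ negInfty) : 0 < cayley z := by
  rw [cayley_of_ne hz]
  have := z.toReal_nonpos
  exact one_div_pos.2 (by linarith)

theorem cayley_nonneg (z : NegHalfLine) : 0 ≤ cayley z := by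
  by_cases hz : z = negInfty
  · rw [hz, cayley_negInfty]
  · exact (cayley_pos hz).le

theorem cayley_le_one (z : NegHalfLine) : cayley z ≤ 1 := by
  by_cases hz : z = negInfty
  · rw [hz, cayley_negInfty]; exact zero_le_one
  · rw [cayley_of_ne hz]
    have := z.toReal_nonpos
    exact (div_le_one (by linarith)).2 (by linarith)

theorem NegHalfLine.coe_toReal {z : NegHalfLine} (hz : z ≠ negInfty) :
    (((z : EReal).toReal : ℝ) : EReal) = z := by
  refine EReal.coe_toReal ?_ ?_
  · intro h
    have := z.2
    rw [mem_Iic, h] at this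
    simp at this
  · intro h
    exact hz (Subtype.ext h)

theorem cayley_injective : Function.Injective cayley := by
  intro x y h
  by_cases hx : x = negInfty <;> by_cases hy : y = negInfty
  · rw [hx, hy]
  · rw [hx, cayley_negInfty] at h
    exact absurd h (cayley_pos hy).ne
  · rw [hy, cayley_negInfty] at h
    exact absurd h (cayley_pos hx).ne'
  · rw [cayley_of_ne hx, cayley_of_ne hy, one_div, one_div, inv_inj] at h
    have h' : (x : EReal).toReal = (y : EReal).toReal := by linarith
    refine Subtype.ext ?_
    rw [← NegHalfLine.coe_toReal hx, ← NegHalfLine.coe_toReal hy, h']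

theorem cayley_zeroPt : cayley zeroPt = 1 := by
  have h : zeroPt ≠ negInfty := by
    intro h
    have := congrArg (fun z : NegHalfLine => (z : EReal)) h
    simp [zeroPt, negInfty] at this
  rw [cayley_of_ne h]
  simp [zeroPt]

theorem continuous_cayley : Continuous cayley := by
  have key : cayley = fun z : NegHalfLine => ((1 + (-(z : EReal)).toENNReal)⁻¹).toReal := by
    funext z
    by_cases hz : z = negInfty
    · rw [hz, cayley_negInfty]
      simp [negInfty]
    · rw [cayley_of_ne hz]
      have hx := z.toReal_nonpos
      have := NegHalfLine.coe_toReal hz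
      set x := (z : EReal).toReal with hxd
      rw [← this, ← EReal.coe_neg, ENNReal.toReal_inv, EReal.toENNReal_of_ne_top (by simp),
        ENNReal.toReal_add (by simp) (by simp), EReal.toReal_coe,
        ENNReal.toReal_ofReal (by linarith)]
      simp [sub_eq_add_neg]
  rw [key]
  have h1 : Continuous fun z : NegHalfLine => (1 + (-(z : EReal)).toENNReal)⁻¹ := by
    have h2 : Continuous fun z : NegHalfLine => (-(z : EReal)).toENNReal :=
      EReal.continuous_toENNReal.comp (continuous_neg.comp continuous_subtype_val)
    fun_prop
  refine ENNReal.continuousOn_toReal.comp_continuous h1 fun z => ?_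
  simp

instance compactSpace_negHalfLine : CompactSpace NegHalfLine :=
  isCompact_iff_compactSpace.1 isClosed_Iic.isCompact

theorem integrable_of_continuous (μ : Measure NegHalfLine) [IsFiniteMeasure μ] {f : NegHalfLine → ℝ}
    (hf : Continuous f) : Integrable f μ :=
  hf.integrable_of_hasCompactSupport (HasCompactSupport.of_compactSpace f)

/-! ### The Cauchy transform and the potential in the bounded coordinate -/

theorem one_add_mul_cayley_pos {t : ℝ} (ht : 0 < t) (z : NegHalfLine) :
    0 < 1 + (t - 1) * cayley z := by
  have h0 := cayley_nonneg z
  have h1 := cayley_le_one z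
  rcases h0.eq_or_lt with h | h
  · rw [← h]; norm_num
  · nlinarith [mul_pos ht h]

/-- The kernel `1 / (t - z)` of the Cauchy transform, extended by `0` to `z = -∞` and written in
the coordinate `cayley z`. -/
def cauchyKernel (t : ℝ) (z : NegHalfLine) : ℝ := cayley z / (1 + (t - 1) * cayley z)

theorem continuous_cauchyKernel {t : ℝ} (ht : 0 < t) : Continuous (cauchyKernel t) :=
  continuous_cayley.div (continuous_const.add (continuous_const.mul continuous_cayley))
    fun z => (one_add_mul_cayley_pos ht z).ne'

theorem continuous_log_one_add_mul_cayley {t : ℝ} (ht : 0 < t) :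
    Continuous fun z : NegHalfLine => Real.log (1 + (t - 1) * cayley z) :=
  (continuous_const.add (continuous_const.mul continuous_cayley)).log
    fun z => (one_add_mul_cayley_pos ht z).ne'

theorem cauchyKernel_nonneg {t : ℝ} (ht : 0 < t) (z : NegHalfLine) : 0 ≤ cauchyKernel t z :=
  div_nonneg (cayley_nonneg z) (one_add_mul_cayley_pos ht z).le

theorem mul_cauchyKernel_le_one {t : ℝ} (ht : 0 < t) (z : NegHalfLine) :
    t * cauchyKernel t z ≤ 1 := by
  rw [cauchyKernel, ← mul_div_assoc, div_le_one (one_add_mul_cayley_pos ht z)]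
  linarith [cayley_le_one z]

theorem setIntegral_compl_negInfty (μ : Measure NegHalfLine) {f k : NegHalfLine → ℝ}
    (h : ∀ z, z ≠ negInfty → f z = k z) (h0 : k negInfty = 0) :
    ∫ z in {negInfty}ᶜ, f z ∂μ = ∫ z, k z ∂μ := by
  rw [← integral_indicator (measurableSet_singleton negInfty).compl]
  congr 1
  funext z
  by_cases hz : z = negInfty
  · simp [hz, h0]
  · simp [hz, h z hz]

theorem cauchyTransform_eq (μ : Measure NegHalfLine) {t : ℝ} (ht : 0 < t) :
    cauchyTransform μ t = ∫ z, cauchyKernel t z ∂μ := by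
  refine setIntegral_compl_negInfty μ (fun z hz => ?_) (by simp [cauchyKernel, cayley_negInfty])
  rw [cauchyKernel, cayley_of_ne hz]
  have h := z.toReal_nonpos
  have h1 : 1 - (z : EReal).toReal ≠ 0 := by linarith
  have h2 : t - (z : EReal).toReal ≠ 0 := by linarith
  have h3 : 1 + (t - 1) * (1 / (1 - (z : EReal).toReal)) =
      (t - (z : EReal).toReal) / (1 - (z : EReal).toReal) := by field_simp; ring
  rw [h3]
  field_simp

theorem logPotential_eq (μ : Measure NegHalfLine) (t : ℝ) :
    logPotential μ t = ∫ z, Real.log (1 + (t - 1) * cayley z) ∂μ := by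
  refine setIntegral_compl_negInfty μ (fun z hz => ?_) (by simp [cayley_negInfty])
  rw [cayley_of_ne hz]
  have h := z.toReal_nonpos
  have h1 : 1 - (z : EReal).toReal ≠ 0 := by linarith
  congr 1
  field_simp
  ring

/-- The integrals `∫ μ(dz) / (t - z) ^ k` over `(-∞, 0]`, for `k ≥ 1`; for `k = 0` the point `-∞`
contributes its mass as well. -/
def cauchyMoment (μ : Measure NegHalfLine) (k : ℕ) (t : ℝ) : ℝ := ∫ z, cauchyKernel t z ^ k ∂μ

theorem hasDerivAt_cauchyKernel {t : ℝ} (ht : 0 < t) (z : NegHalfLine) :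
    HasDerivAt (fun s => cauchyKernel s z) (-cauchyKernel t z ^ 2) t := by
  have h := (one_add_mul_cayley_pos ht z).ne'
  have h1 : HasDerivAt (fun s : ℝ => 1 + (s - 1) * cayley z) (cayley z) t := by
    simpa using (((hasDerivAt_id t).sub_const 1).mul_const (cayley z)).const_add 1
  have h2 := (hasDerivAt_const t (cayley z)).fun_div h1 h
  refine h2.congr_deriv ?_
  simp only [cauchyKernel]
  field_simp
  ring

theorem hasDerivAt_cauchyMoment (μ : Measure NegHalfLine) [IsFiniteMeasure μ] (k : ℕ) {t : ℝ}
    (ht : 0 < t) : HasDerivAt (cauchyMoment μ k) (-(k * cauchyMoment μ (k + 1) t)) t := by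
  have key := (hasDerivAt_integral_of_dominated_loc_of_deriv_le (μ := μ) (x₀ := t)
    (s := Ioi (t / 2)) (F := fun s z => cauchyKernel s z ^ k)
    (F' := fun s z => -(k * cauchyKernel s z ^ (k + 1)))
    (bound := fun _ => k * (2 / t) ^ (k + 1)) (Ioi_mem_nhds (by linarith))
    (by
      filter_upwards [Ioi_mem_nhds ht] with s hs
      exact ((continuous_cauchyKernel hs).pow k).aestronglyMeasurable)
    (integrable_of_continuous μ ((continuous_cauchyKernel ht).pow k))
    (by
      have := continuous_cauchyKernel ht
      exact (by fun_prop : Continuous fun z => -(k * cauchyKernel t z ^ (k + 1))).aestronglyMeasurable)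
    (ae_of_all _ fun z s hs => by
      have hs0 : 0 < s := lt_trans (by linarith) hs
      have h1 := cauchyKernel_nonneg hs0 z
      rw [norm_neg, Real.norm_of_nonneg (by positivity)]
      have h2 := mul_cauchyKernel_le_one hs0 z
      have h3 : cauchyKernel s z ≤ 2 / t := by
        rw [le_div_iff₀ ht]
        have : t / 2 < s := hs
        nlinarith
      gcongr)
    (integrable_const _)
    (ae_of_all _ fun z s hs => by
      have hs0 : 0 < s := lt_trans (by linarith) hs
      refine ((hasDerivAt_cauchyKernel hs0 z).fun_pow k).congr_deriv ?_
      rcases k with _ | k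
      · simp
      · rw [Nat.add_sub_cancel]
        ring)).2
  rw [integral_neg, integral_const_mul] at key
  exact key

theorem hasDerivAt_logPotential (μ : Measure NegHalfLine) [IsFiniteMeasure μ] {t : ℝ}
    (ht : 0 < t) : HasDerivAt (logPotential μ) (cauchyMoment μ 1 t) t := by
  have key := (hasDerivAt_integral_of_dominated_loc_of_deriv_le (μ := μ) (x₀ := t)
    (s := Ioi (t / 2)) (F := fun s z => Real.log (1 + (s - 1) * cayley z))
    (F' := fun s z => cauchyKernel s z ^ 1)
    (bound := fun _ => 2 / t) (Ioi_mem_nhds (by linarith))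
    (by
      filter_upwards [Ioi_mem_nhds ht] with s hs
      exact (continuous_log_one_add_mul_cayley hs).aestronglyMeasurable)
    (integrable_of_continuous μ (continuous_log_one_add_mul_cayley ht))
    ((continuous_cauchyKernel ht).pow 1).aestronglyMeasurable
    (ae_of_all _ fun z s hs => by
      have hs0 : 0 < s := lt_trans (by linarith) hs
      have h1 := cauchyKernel_nonneg hs0 z
      rw [pow_one, Real.norm_of_nonneg h1]
      have h2 := mul_cauchyKernel_le_one hs0 z
      rw [le_div_iff₀ ht]
      have : t / 2 < s := hs
      nlinarith)
    (integrable_const _)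
    (ae_of_all _ fun z s hs => by
      have hs0 : 0 < s := lt_trans (by linarith) hs
      have h1 : HasDerivAt (fun s : ℝ => 1 + (s - 1) * cayley z) (cayley z) s := by
        simpa using (((hasDerivAt_id s).sub_const 1).mul_const (cayley z)).const_add 1
      simpa [cauchyKernel] using h1.log (one_add_mul_cayley_pos hs0 z).ne')).2
  have h : logPotential μ = fun t => ∫ z, Real.log (1 + (t - 1) * cayley z) ∂μ :=
    funext (logPotential_eq μ)
  rw [h]
  exact key

theorem contDiffOn_cauchyMoment (μ : Measure NegHalfLine) [IsFiniteMeasure μ] (k : ℕ) :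
    ContDiffOn ℝ ((⊤ : ℕ∞) : WithTop ℕ∞) (cauchyMoment μ k) (Ioi 0) := by
  refine contDiffOn_infty.2 fun n => ?_
  induction n generalizing k with
  | zero =>
    exact contDiffOn_zero.2 fun t ht =>
      (hasDerivAt_cauchyMoment μ k ht).continuousAt.continuousWithinAt
  | succ n ih =>
    push_cast
    rw [contDiffOn_succ_iff_deriv_of_isOpen isOpen_Ioi]
    refine ⟨fun t ht => (hasDerivAt_cauchyMoment μ k ht).differentiableAt.differentiableWithinAt,
      by simp, ?_⟩
    exact (contDiffOn_const.mul (ih (k + 1))).neg.congr fun t ht =>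
      (hasDerivAt_cauchyMoment μ k ht).deriv

/-- The Cauchy transform on `(0, ∞)` determines the measure: its successive derivatives at `1` are
the moments of the bounded coordinate `cayley`. -/
theorem eq_of_cauchyMoment_one_eqOn (μ ν : ProbabilityMeasure NegHalfLine)
    (h : ∀ t : ℝ, 0 < t → cauchyMoment μ 1 t = cauchyMoment ν 1 t) : μ = ν := by
  have hk : ∀ k : ℕ, ∀ t : ℝ, 0 < t → cauchyMoment μ (k + 1) t = cauchyMoment ν (k + 1) t := by
    intro k
    induction k with
    | zero => exact h
    | succ k ih =>
      intro t ht
      have h1 := hasDerivAt_cauchyMoment (μ : Measure NegHalfLine) (k + 1) ht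
      have h2 := hasDerivAt_cauchyMoment (ν : Measure NegHalfLine) (k + 1) ht
      have h3 := h1.congr_of_eventuallyEq (f₁ := cauchyMoment ν (k + 1)) (by
        filter_upwards [Ioi_mem_nhds ht] with s hs using (ih s hs).symm)
      have h4 := h3.unique h2
      have h5 : ((k + 1 : ℕ) : ℝ) ≠ 0 := by positivity
      exact mul_left_cancel₀ h5 (neg_injective h4)
  have hmom : ∀ k : ℕ, ∫ z, cayley z ^ k ∂(μ : Measure NegHalfLine) =
      ∫ z, cayley z ^ k ∂(ν : Measure NegHalfLine) := by
    intro k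
    rcases k with _ | k
    · simp
    · simpa [cauchyMoment, cauchyKernel] using hk k 1 one_pos
  let c : BoundedContinuousFunction NegHalfLine ℝ :=
    BoundedContinuousFunction.mkOfCompact ⟨cayley, continuous_cayley⟩
  have hc : ∀ z, c z = cayley z := fun z => rfl
  have hsep : ((StarAlgebra.adjoin ℝ {c}).map
      (BoundedContinuousFunction.toContinuousMapStarₐ ℝ)).SeparatesPoints := by
    intro x y hxy
    refine ⟨cayley, ⟨BoundedContinuousFunction.toContinuousMapStarₐ ℝ c, ?_, rfl⟩,
      fun e => hxy (cayley_injective e)⟩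
    exact ⟨c, StarAlgebra.subset_adjoin ℝ _ (mem_singleton c), rfl⟩
  have : PolishSpace NegHalfLine := isClosed_Iic.polishSpace
  suffices (μ : Measure NegHalfLine) = (ν : Measure NegHalfLine) from Subtype.ext this
  refine ext_of_forall_mem_subalgebra_integral_eq_of_polish (𝕜 := ℝ) hsep fun f hf => ?_
  have hf' : f ∈ Algebra.adjoin ℝ {c} := by
    rw [← StarSubalgebra.mem_toSubalgebra, StarAlgebra.adjoin_toSubalgebra] at hf
    have hs : star ({c} : Set (BoundedContinuousFunction NegHalfLine ℝ)) = {c} := by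
      rw [Set.star_singleton]
      congr 1
    rwa [hs, union_self] at hf
  rw [Algebra.adjoin_singleton_eq_range_aeval] at hf'
  obtain ⟨p, rfl⟩ := hf'
  have hp : ∀ z, (Polynomial.aeval c p : BoundedContinuousFunction NegHalfLine ℝ) z =
      p.sum fun k a => a * cayley z ^ k := by
    intro z
    rw [Polynomial.aeval_eq_sum_range, Polynomial.sum_over_range _ (by simp)]
    simp [BoundedContinuousFunction.sum_apply, hc]
  have hint : ∀ κ : ProbabilityMeasure NegHalfLine,
      ∫ z, (Polynomial.aeval c p : BoundedContinuousFunction NegHalfLine ℝ) z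
        ∂(κ : Measure NegHalfLine) =
      p.sum fun k a => a * ∫ z, cayley z ^ k ∂(κ : Measure NegHalfLine) := by
    intro κ
    simp only [hp, Polynomial.sum_def]
    rw [integral_finsetSum]
    · simp only [integral_const_mul]
    · intro k _
      exact (integrable_of_continuous _ (continuous_cayley.pow k)).const_mul _
  refine (hint μ).trans (Eq.trans ?_ (hint ν).symm)
  simp only [hmom]

/-! ### Log-concavity of the coefficients -/

/-- A nonnegative sequence is log-concave without internal zeros, in the two-index form
`u i * u (j + 2) ≤ u (i + 1) * u (j + 1)` for `i ≤ j`, which survives multiplication by linear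
factors. -/
def LogConcaveSeq (u : ℕ → ℝ) : Prop :=
  ∀ i j, i ≤ j → u i * u (j + 2) ≤ u (i + 1) * u (j + 1)

/-- Multiplying a polynomial by `X + r` with `r ≥ 0` preserves log-concavity of the coefficients. -/
theorem LogConcaveSeq.mul_X_add_C {Q : Polynomial ℝ} (h0 : ∀ k, 0 ≤ Q.coeff k)
    (hQ : LogConcaveSeq Q.coeff) {r : ℝ} (hr : 0 ≤ r) :
    LogConcaveSeq (Q * (Polynomial.X + Polynomial.C r)).coeff := by
  have hz : (Q * (Polynomial.X + Polynomial.C r)).coeff 0 = r * Q.coeff 0 := by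
    simp [mul_add, mul_comm]
  have hs : ∀ k, (Q * (Polynomial.X + Polynomial.C r)).coeff (k + 1) =
      Q.coeff k + r * Q.coeff (k + 1) := by
    intro k
    simp [mul_add, mul_comm]
  have hcomm : ∀ i j, i ≤ j → Q.coeff i * Q.coeff (j + 1) ≤ Q.coeff (i + 1) * Q.coeff j := by
    intro i j hij
    rcases hij.eq_or_lt with rfl | h
    · rw [mul_comm]
    · obtain ⟨m, rfl⟩ : ∃ m, j = m + 1 := ⟨j - 1, by omega⟩
      exact hQ i m (by omega)
  intro i j hij
  rcases i with _ | i
  · rw [hz, hs, hs, hs]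
    have h1 := hQ 0 j (by omega)
    have h2 := hcomm 0 j (by omega)
    simp only [zero_add] at h1 h2 ⊢
    have h3 := mul_nonneg (h0 0) (h0 j)
    nlinarith [mul_le_mul_of_nonneg_left h1 (mul_nonneg hr hr), mul_le_mul_of_nonneg_left h2 hr,
      mul_nonneg hr (mul_nonneg (h0 0) (h0 (j + 1))), mul_nonneg hr (mul_nonneg (h0 1) (h0 j))]
  · obtain ⟨j, rfl⟩ : ∃ m, j = m + 1 := ⟨j - 1, by omega⟩
    rw [hs, hs, hs, hs]
    have h1 := hcomm i (j + 1) (by omega)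
    have h2 := hQ (i + 1) (j + 1) hij
    have h3 := hQ i (j + 1) (by omega)
    have h4 := hcomm (i + 1) (j + 1) hij
    simp only [add_assoc, Nat.reduceAdd] at h1 h2 h3 h4 ⊢
    nlinarith [mul_le_mul_of_nonneg_left h2 (mul_nonneg hr hr), mul_le_mul_of_nonneg_left h3 hr,
      mul_le_mul_of_nonneg_left h4 hr]

/-- A nonnegative constant times a product of factors `X + r` with `r ≥ 0` has nonnegative
log-concave coefficients. -/
theorem logConcaveSeq_C_mul_prod {c : ℝ} (hc : 0 ≤ c) (s : Multiset ℝ) (hs : ∀ r ∈ s, 0 ≤ r) :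
    (∀ k, 0 ≤ (Polynomial.C c *
      (s.map fun r => Polynomial.X + Polynomial.C r).prod).coeff k) ∧
    LogConcaveSeq (Polynomial.C c *
      (s.map fun r => Polynomial.X + Polynomial.C r).prod).coeff := by
  induction s using Multiset.induction_on with
  | empty =>
    simp only [Multiset.map_zero, Multiset.prod_zero, mul_one]
    refine ⟨fun k => ?_, fun i j _ => ?_⟩
    · rw [Polynomial.coeff_C]
      split_ifs <;> simp [hc]
    · simp [Polynomial.coeff_C]
  | cons r s ih =>
    obtain ⟨h1, h2⟩ := ih fun x hx => hs x (Multiset.mem_cons_of_mem hx)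
    have hr := hs r (Multiset.mem_cons_self r s)
    rw [Multiset.map_cons, Multiset.prod_cons,
      mul_comm (Polynomial.X + Polynomial.C r), ← mul_assoc]
    refine ⟨fun k => ?_, h2.mul_X_add_C h1 hr⟩
    rw [mul_add, Polynomial.coeff_add, Polynomial.coeff_mul_C]
    refine add_nonneg ?_ (mul_nonneg (h1 k) hr)
    rcases k with _ | k
    · simp
    · rw [Polynomial.coeff_mul_X]
      exact h1 k

/-- A log-concave sequence has no internal zeros. -/
theorem LogConcaveSeq.pos_of_mem_Icc {u : ℕ → ℝ} (h0 : ∀ k, 0 ≤ u k) (hu : LogConcaveSeq u)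
    {i k : ℕ} (hi : 0 < u i) (hk : 0 < u k) {j : ℕ} (hij : i ≤ j) (hjk : j ≤ k) : 0 < u j := by
  induction j, hij using Nat.le_induction generalizing hk with
  | base => exact hi
  | succ j hij ih =>
    have hj := ih hk (by omega)
    have : ∀ m, j + 1 + m = k → 0 < u (j + 1) := by
      clear ih hjk
      intro m
      induction m generalizing k with
      | zero => rintro rfl; exact hk
      | succ m ihm =>
        intro hm
        have h1 := hu j (j + m) (by omega)
        rw [show j + m + 2 = k by omega] at h1
        have h2 : 0 < u (j + 1) * u (j + m + 1) := lt_of_lt_of_le (mul_pos hj hk) h1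
        exact (pos_iff_pos_of_mul_pos h2).2 ((h0 _).lt_of_ne fun h => by simp [← h] at h2)
    exact this (k - (j + 1)) (by omega)

/-- The logarithm of a log-concave sequence lies above its chords. -/
theorem LogConcaveSeq.log_chord_le {u : ℕ → ℝ} (h0 : ∀ k, 0 ≤ u k) (hu : LogConcaveSeq u)
    {i j k : ℕ} (hi : 0 < u i) (hk : 0 < u k) (hij : i ≤ j) (hjk : j ≤ k) :
    ((k : ℝ) - j) * Real.log (u i) + ((j : ℝ) - i) * Real.log (u k) ≤
      ((k : ℝ) - i) * Real.log (u j) := by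
  have hpos : ∀ m, i ≤ m → m ≤ k → 0 < u m := fun m h1 h2 =>
    hu.pos_of_mem_Icc h0 hi hk h1 h2
  rcases hjk.eq_or_lt with rfl | hjk
  · simp
  -- by log-concavity the increment at `j` is at most every increment before it and at least every
  -- increment after it
  set d := Real.log (u (j + 1)) - Real.log (u j) with hd
  have hstep : ∀ m n, i ≤ m → m ≤ n → n + 1 ≤ k →
      Real.log (u (n + 1)) - Real.log (u n) ≤ Real.log (u (m + 1)) - Real.log (u m) := by
    intro m n him hmn hnk
    rcases hmn.eq_or_lt with rfl | hmn
    · exact le_rfl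
    obtain ⟨n, rfl⟩ : ∃ l, n = l + 1 := ⟨n - 1, by omega⟩
    have h := hu m n (by omega)
    have p1 := hpos m him (by omega)
    have p2 := hpos (m + 1) (by omega) (by omega)
    have p3 := hpos (n + 1) (by omega) (by omega)
    have p4 := hpos (n + 1 + 1) (by omega) (by omega)
    have := Real.log_le_log (mul_pos p1 p4) h
    rw [Real.log_mul p1.ne' p4.ne', Real.log_mul p2.ne' p3.ne'] at this
    linarith
  have hleft : ∀ m, i + m ≤ j → (m : ℝ) * d ≤ Real.log (u (i + m)) - Real.log (u i) := by
    intro m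
    induction m with
    | zero => simp
    | succ m ih =>
      intro hm
      have h1 := ih (by omega)
      have h2 := hstep (i + m) j (by omega) (by omega) (by omega)
      push_cast
      rw [← add_assoc i m 1]
      linarith
  have hright : ∀ m, j + m ≤ k → Real.log (u (j + m)) - Real.log (u j) ≤ (m : ℝ) * d := by
    intro m
    induction m with
    | zero => simp
    | succ m ih =>
      intro hm
      have h1 := ih (by omega)
      have h2 := hstep j (j + m) (by omega) (by omega) (by omega)
      push_cast
      rw [← add_assoc j m 1]
      linarith
  obtain ⟨p, rfl⟩ := Nat.exists_eq_add_of_le hij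
  obtain ⟨q, rfl⟩ := Nat.exists_eq_add_of_le hjk.le
  have h1 := hleft p le_rfl
  have h2 := hright q le_rfl
  push_cast
  have h3 := mul_le_mul_of_nonneg_left h1 (Nat.cast_nonneg (α := ℝ) q)
  have h4 := mul_le_mul_of_nonneg_left h2 (Nat.cast_nonneg (α := ℝ) p)
  nlinarith

/-! ### Polynomials with only real nonpositive roots -/

theorem HasOnlyNonposRoots.mem_aroots {P : Polynomial ℝ} (hP : HasOnlyNonposRoots P) {z : ℂ}
    (hz : z ∈ P.aroots ℂ) : z.re ≤ 0 ∧ z = (z.re : ℂ) := by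
  obtain ⟨x, hx, rfl⟩ := hP z (Polynomial.mem_aroots.1 hz).2
  simpa using hx

theorem HasOnlyNonposRoots.eq_C_mul_prod {P : Polynomial ℝ} (hP : HasOnlyNonposRoots P) :
    P = Polynomial.C P.leadingCoeff *
      (((P.aroots ℂ).map fun z => -z.re).map fun r => Polynomial.X + Polynomial.C r).prod := by
  apply Polynomial.map_injective (algebraMap ℝ ℂ) (algebraMap ℝ ℂ).injective
  have h := (IsAlgClosed.splits (P.map (algebraMap ℝ ℂ))).eq_prod_roots
  rw [h, Polynomial.map_mul, Polynomial.map_C, Polynomial.map_multiset_prod,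
    Polynomial.leadingCoeff_map, Multiset.map_map, Multiset.map_map]
  congr 2
  refine Multiset.map_congr rfl fun z hz => ?_
  have h1 := (hP.mem_aroots (z := z) hz).2
  simp only [Function.comp, Polynomial.map_add, Polynomial.map_X, map_neg, Polynomial.map_neg]
  rw [sub_eq_add_neg, Polynomial.map_C]
  congr 3

theorem HasOnlyNonposRoots.logConcaveSeq_coeff {P : Polynomial ℝ} (hP : HasOnlyNonposRoots P)
    (h0 : ∀ k, 0 ≤ P.coeff k) : LogConcaveSeq P.coeff := by
  rw [hP.eq_C_mul_prod]
  refine (logConcaveSeq_C_mul_prod (h0 _) _ fun r hr => ?_).2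
  obtain ⟨z, hz, rfl⟩ := Multiset.mem_map.1 hr
  have := (hP.mem_aroots hz).1
  linarith

theorem HasOnlyNonposRoots.eval_eq {P : Polynomial ℝ} (hP : HasOnlyNonposRoots P) (t : ℝ) :
    P.eval t = P.leadingCoeff * ((P.aroots ℂ).map fun z => t - z.re).prod := by
  conv_lhs => rw [hP.eq_C_mul_prod]
  rw [Polynomial.eval_mul, Polynomial.eval_C, Polynomial.eval_multiset_prod, Multiset.map_map,
    Multiset.map_map]
  simp [sub_eq_add_neg]

/-! ### Empirical distributions of zeros on the half-line -/

/-- The point of `[-∞, 0]` corresponding to a complex number `z`, meaningful when `z` is real and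
nonpositive. -/
def halfLinePt (z : ℂ) : NegHalfLine :=
  ⟨((min z.re 0 : ℝ) : EReal), by
    rw [mem_Iic, ← EReal.coe_zero, EReal.coe_le_coe_iff]; exact min_le_right _ _⟩

theorem halfLinePt_ne (z : ℂ) : halfLinePt z ≠ negInfty := fun h =>
  EReal.coe_ne_bot _ (congrArg Subtype.val h)

theorem toReal_halfLinePt {z : ℂ} (hz : z.re ≤ 0) :
    ((halfLinePt z : NegHalfLine) : EReal).toReal = z.re := by
  simp [halfLinePt, hz]

theorem toSphere_halfLinePt {z : ℂ} (hz : z.re ≤ 0) (hz' : z = (z.re : ℂ)) :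
    toSphere (halfLinePt z) = (z : OnePoint ℂ) := by
  rw [toSphere, if_neg (halfLinePt_ne z), toReal_halfLinePt hz, ← hz']

theorem toSphere_negInfty : toSphere negInfty = OnePoint.infty := by simp [toSphere]

/-- The empirical distribution of zeros as a measure on `[-∞, 0]`; it represents `empiricalZeros`
when all zeros are real and nonpositive. -/
def halfLineZeros (n : ℕ) (P : Polynomial ℝ) : Measure NegHalfLine :=
  (n : ENNReal)⁻¹ • ((P.aroots ℂ).map fun z => Measure.dirac (halfLinePt z)).sum +
    (((n - P.natDegree : ℕ) : ENNReal) / (n : ENNReal)) • Measure.dirac negInfty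

theorem MeasureTheory.Measure.map_multiset_sum {ι α β : Type*} [MeasurableSpace α]
    [MeasurableSpace β] {f : α → β} (hf : Measurable f) (s : Multiset ι) (m : ι → Measure α) :
    (s.map m).sum.map f = (s.map fun i => (m i).map f).sum := by
  induction s using Multiset.induction_on with
  | empty => simp
  | cons a s ih => simp [Measure.map_add _ _ hf, ih]

theorem HasOnlyNonposRoots.map_toSphere_halfLineZeros {P : Polynomial ℝ}
    (hP : HasOnlyNonposRoots P) (n : ℕ) :
    (halfLineZeros n P).map toSphere = empiricalZeros n P := by
  rw [halfLineZeros, empiricalZeros, Measure.map_add _ _ measurable_toSphere, Measure.map_smul,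
    Measure.map_smul, Measure.map_multiset_sum measurable_toSphere,
    Measure.map_dirac' measurable_toSphere, toSphere_negInfty]
  congr 3
  refine Multiset.map_congr rfl fun z hz => ?_
  obtain ⟨h1, h2⟩ := hP.mem_aroots hz
  rw [Measure.map_dirac' measurable_toSphere, toSphere_halfLinePt h1 h2]

theorem card_aroots_complex (P : Polynomial ℝ) :
    Multiset.card (P.aroots ℂ) = P.natDegree := by
  have h := (IsAlgClosed.splits (P.map (algebraMap ℝ ℂ))).natDegree_eq_card_roots
  rw [Polynomial.natDegree_map] at h
  exact h.symm

theorem sum_map_dirac_apply_univ {ι : Type*} (s : Multiset ι) (x : ι → NegHalfLine) :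
    (s.map fun i => Measure.dirac (x i)).sum univ = Multiset.card s := by
  induction s using Multiset.induction_on with
  | empty => simp
  | cons a s ih => simp [ih, add_comm]

theorem isProbabilityMeasure_halfLineZeros {n : ℕ} (hn : n ≠ 0) {P : Polynomial ℝ}
    (hP : P.natDegree ≤ n) : IsProbabilityMeasure (halfLineZeros n P) := by
  constructor
  have hn' : (n : ENNReal) ≠ 0 := by simpa using hn
  rw [halfLineZeros, Measure.add_apply, Measure.smul_apply, Measure.smul_apply,
    sum_map_dirac_apply_univ, card_aroots_complex]
  simp only [measure_univ, smul_eq_mul, mul_one]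
  rw [mul_comm, ← div_eq_mul_inv, ENNReal.div_add_div_same, ← Nat.cast_add,
    Nat.add_sub_cancel' hP, ENNReal.div_self hn' (by simp)]

theorem integral_sum_map_dirac {ι : Type*} (s : Multiset ι) (x : ι → NegHalfLine)
    {f : NegHalfLine → ℝ} (hf : Continuous f) :
    Integrable f (s.map fun i => Measure.dirac (x i)).sum ∧
      ∫ z, f z ∂(s.map fun i => Measure.dirac (x i)).sum = (s.map fun i => f (x i)).sum := by
  induction s using Multiset.induction_on with
  | empty => simp
  | cons a s ih =>
    have h := integrable_of_continuous (Measure.dirac (x a)) hf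
    simp only [Multiset.map_cons, Multiset.sum_cons]
    refine ⟨h.add_measure ih.1, ?_⟩
    rw [integral_add_measure h ih.1, ih.2, integral_dirac]

theorem integral_halfLineZeros {n : ℕ} (P : Polynomial ℝ) {f : NegHalfLine → ℝ}
    (hn : n ≠ 0) (hf : Continuous f) (h0 : f negInfty = 0) :
    ∫ z, f z ∂(halfLineZeros n P) =
      (n : ℝ)⁻¹ * ((P.aroots ℂ).map fun z => f (halfLinePt z)).sum := by
  obtain ⟨h1, h2⟩ := integral_sum_map_dirac (P.aroots ℂ) halfLinePt hf
  have hn' : (n : ENNReal) ≠ 0 := by simpa using hn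
  rw [halfLineZeros, integral_add_measure (h1.smul_measure (by simpa using hn))
    ((integrable_of_continuous _ hf).smul_measure (ENNReal.div_ne_top (by simp) hn')),
    integral_smul_measure, integral_smul_measure, h2, integral_dirac, h0]
  simp

theorem Real.log_multiset_prod_map {ι : Type*} (s : Multiset ι) {f : ι → ℝ}
    (hf : ∀ i ∈ s, f i ≠ 0) : Real.log (s.map f).prod = (s.map fun i => Real.log (f i)).sum := by
  induction s using Multiset.induction_on with
  | empty => simp
  | cons a s ih =>
    have h1 : ∀ i ∈ s, f i ≠ 0 := fun i hi => hf i (Multiset.mem_cons_of_mem hi)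
    have h2 : (s.map f).prod ≠ 0 := Multiset.prod_ne_zero fun h => by
      obtain ⟨i, hi, hi'⟩ := Multiset.mem_map.1 h
      exact h1 i hi hi'
    rw [Multiset.map_cons, Multiset.prod_cons, Multiset.map_cons, Multiset.sum_cons,
      Real.log_mul (hf a (Multiset.mem_cons_self a s)) h2, ih h1]

/-- The logarithmic potential of the empirical distribution of zeros of `P` at `t` is
`(1 / n) log (P t / P 1)`. -/
theorem HasOnlyNonposRoots.logPotential_halfLineZeros {P : Polynomial ℝ}
    (hP : HasOnlyNonposRoots P) (hP0 : P ≠ 0) {n : ℕ} (hn : n ≠ 0) {t : ℝ} (ht : 0 < t) :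
    logPotential (halfLineZeros n P) t =
      (n : ℝ)⁻¹ * (Real.log (P.eval t) - Real.log (P.eval 1)) := by
  rw [logPotential_eq, integral_halfLineZeros P hn (continuous_log_one_add_mul_cayley ht)
    (by simp [cayley_negInfty])]
  congr 1
  have hpos : ∀ s : ℝ, 0 < s → ∀ z ∈ P.aroots ℂ, s - z.re ≠ 0 := by
    intro s hs z hz
    have := (hP.mem_aroots hz).1
    linarith
  have hl : P.leadingCoeff ≠ 0 := Polynomial.leadingCoeff_ne_zero.2 hP0
  have hlog : ∀ s : ℝ, 0 < s → Real.log (P.eval s) =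
      Real.log P.leadingCoeff + ((P.aroots ℂ).map fun z => Real.log (s - z.re)).sum := by
    intro s hs
    rw [hP.eval_eq s, Real.log_mul hl, Real.log_multiset_prod_map _ (hpos s hs)]
    exact Multiset.prod_ne_zero fun h => by
      obtain ⟨z, hz, hz'⟩ := Multiset.mem_map.1 h
      exact hpos s hs z hz hz'
  rw [hlog t ht, hlog 1 one_pos, add_sub_add_left_eq_sub, ← Multiset.sum_map_sub]
  congr 1
  refine Multiset.map_congr rfl fun z hz => ?_
  have h1 := hpos t ht z hz
  have h2 := hpos 1 one_pos z hz
  rw [← Real.log_div h1 h2, cayley_of_ne (halfLinePt_ne z),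
    toReal_halfLinePt (hP.mem_aroots hz).1]
  congr 1
  field_simp
  ring

/-! ### Log-concave triangular arrays with an exponential profile -/

/-- Real-valued form of an exponential profile for a triangular array `u` with nonnegative entries
and eventually log-concave rows: the convention `log 0 = -∞` is replaced by positivity
conditions. -/
structure LogConcaveProfile (u : ℕ → ℕ → ℝ) (a b : ℝ) (g : ℝ → ℝ) : Prop where
  nonneg : ∀ n k, 0 ≤ u n k
  eq_zero : ∀ n k, n < k → u n k = 0
  logConcave : ∀ᶠ n in atTop, LogConcaveSeq (u n)
  left_nonneg : 0 ≤ a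
  lt : a < b
  right_le_one : b ≤ 1
  pos_inside : ∀ α ∈ Ioo a b, ∀ᶠ n : ℕ in atTop, 0 < u n ⌊α * (n : ℝ)⌋₊
  tendsto_inside : ∀ α ∈ Ioo a b,
    Tendsto (fun n : ℕ => Real.log (u n ⌊α * (n : ℝ)⌋₊) / n) atTop (𝓝 (g α))
  le_outside : ∀ α ∈ Ico 0 a ∪ Ioc b 1, ∀ C : ℝ, ∀ᶠ n : ℕ in atTop,
    0 < u n ⌊α * (n : ℝ)⌋₊ → Real.log (u n ⌊α * (n : ℝ)⌋₊) / n ≤ C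

theorem scaledLogCoeff_of_pos {P : ℕ → Polynomial ℝ} {α : ℝ} {n : ℕ}
    (h : 0 < (P n).coeff ⌊α * (n : ℝ)⌋₊) :
    scaledLogCoeff P α n =
      ((Real.log ((P n).coeff ⌊α * (n : ℝ)⌋₊) / n : ℝ) : EReal) := by
  rw [scaledLogCoeff, ENNReal.log_ofReal_of_pos h, ← EReal.coe_mul, one_div_mul_eq_div]

theorem scaledLogCoeff_of_eq_zero {P : ℕ → Polynomial ℝ} {α : ℝ} {n : ℕ} (hn : 0 < n)
    (h : (P n).coeff ⌊α * (n : ℝ)⌋₊ = 0) : scaledLogCoeff P α n = ⊥ := by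
  rw [scaledLogCoeff, h, ENNReal.ofReal_zero, ENNReal.log_zero]
  exact EReal.coe_mul_bot_of_pos (by positivity)

theorem HasExponentialProfile.logConcaveProfile {P : ℕ → Polynomial ℝ} {a b : ℝ} {g : ℝ → ℝ}
    (hg : HasExponentialProfile P a b g) (hroots : ∀ᶠ n in atTop, HasOnlyNonposRoots (P n)) :
    LogConcaveProfile (fun n => (P n).coeff) a b g where
  nonneg := hg.coeff_nonneg
  eq_zero n k h := Polynomial.coeff_eq_zero_of_natDegree_lt ((hg.natDegree_le n).trans_lt h)
  logConcave := hroots.mono fun n h => h.logConcaveSeq_coeff (hg.coeff_nonneg n)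
  left_nonneg := hg.left_nonneg
  lt := hg.lt
  right_le_one := hg.right_le_one
  pos_inside α hα := by
    filter_upwards [(hg.tendsto_inside α hα).eventually_ne (EReal.coe_ne_bot _),
      eventually_gt_atTop 0] with n hn hn0
    exact (hg.coeff_nonneg n _).lt_of_ne' fun h => hn (scaledLogCoeff_of_eq_zero hn0 h)
  tendsto_inside α hα := by
    refine EReal.tendsto_coe.1 ((hg.tendsto_inside α hα).congr' ?_)
    filter_upwards [(hg.tendsto_inside α hα).eventually_ne (EReal.coe_ne_bot _),
      eventually_gt_atTop 0] with n hn hn0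
    exact scaledLogCoeff_of_pos
      ((hg.coeff_nonneg n _).lt_of_ne' fun h => hn (scaledLogCoeff_of_eq_zero hn0 h))
  le_outside α hα C := by
    filter_upwards [(hg.tendsto_outside α hα).eventually_lt_const (EReal.bot_lt_coe C)]
      with n hn hpos
    rw [scaledLogCoeff_of_pos hpos] at hn
    exact (EReal.coe_lt_coe_iff.1 hn).le

namespace LogConcaveProfile

variable {u : ℕ → ℕ → ℝ} {a b : ℝ} {g : ℝ → ℝ}

/-- Exponential tilting adds a linear function to the profile. -/
theorem tilt (h : LogConcaveProfile u a b g) (s : ℝ) :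
    LogConcaveProfile (fun n k => u n k * Real.exp s ^ k) a b fun α => g α + α * s := by
  have hlog : ∀ n k : ℕ, 0 < u n k →
      Real.log (u n k * Real.exp s ^ k) / n = Real.log (u n k) / n + (k : ℝ) / n * s := by
    intro n k hk
    rw [Real.log_mul hk.ne' (by positivity), Real.log_pow, Real.log_exp]
    ring
  refine ⟨fun n k => mul_nonneg (h.nonneg n k) (by positivity), fun n k hk => ?_, ?_,
    h.left_nonneg, h.lt, h.right_le_one, fun α hα => ?_, fun α hα => ?_, fun α hα C => ?_⟩
  · simp [h.eq_zero n k hk]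
  · filter_upwards [h.logConcave] with n hn i j hij
    have h1 : 0 ≤ Real.exp s ^ (i + j + 2) := by positivity
    calc _ = u n i * u n (j + 2) * Real.exp s ^ (i + j + 2) := by ring
      _ ≤ u n (i + 1) * u n (j + 1) * Real.exp s ^ (i + j + 2) :=
        mul_le_mul_of_nonneg_right (hn i j hij) h1
      _ = _ := by ring
  · filter_upwards [h.pos_inside α hα] with n hn
    positivity
  · have h1 := (tendsto_nat_floor_mul_div_atTop (R := ℝ)
      (h.left_nonneg.trans hα.1.le)).comp (tendsto_natCast_atTop_atTop (R := ℝ))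
    refine ((h.tendsto_inside α hα).add (h1.mul_const s)).congr' ?_
    filter_upwards [h.pos_inside α hα] with n hn
    exact (hlog n _ hn).symm
  · filter_upwards [h.le_outside α hα (C - |s|), eventually_gt_atTop 0] with n hn hn0 hpos
    have hα0 : 0 ≤ α ∧ α ≤ 1 := by
      have := h.left_nonneg; have := h.lt; have := h.right_le_one
      rcases hα with ⟨h1, h2⟩ | ⟨h1, h2⟩ <;> constructor <;> linarith
    have hu : 0 < u n ⌊α * (n : ℝ)⌋₊ := (pos_iff_pos_of_mul_pos hpos).2 (by positivity)
    rw [hlog n _ hu]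
    have h1 := hn hu
    have hn0' : (0 : ℝ) < n := by exact_mod_cast hn0
    have h2 : (⌊α * (n : ℝ)⌋₊ : ℝ) / n ≤ 1 := by
      rw [div_le_one hn0']
      refine (Nat.floor_le (by have := hα0.1; positivity)).trans ?_
      nlinarith [hα0.2]
    have h3 : (⌊α * (n : ℝ)⌋₊ : ℝ) / n * s ≤ |s| := by
      refine (mul_le_mul_of_nonneg_left (le_abs_self s) (by positivity)).trans ?_
      nlinarith [abs_nonneg s]
    linarith

/-- The profile at an intermediate point `β` dominates every chord between exponential rates `A` at
`x` and `B` at `z` of entries of the array, even along a subsequence (a filter `U`) and even if the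
end points of the chord lie where the array has no profile. In particular `β` then lies in
`(a, b)`. -/
theorem chord_le (h : LogConcaveProfile u a b g) {U : Filter ℕ} [U.NeBot] (hU : U ≤ atTop)
    {I K : ℕ → ℕ} {x β z A B : ℝ} (hβ0 : 0 ≤ β) (hβ1 : β ≤ 1) (hβa : β ≠ a) (hβb : β ≠ b)
    (hI : Tendsto (fun n => (I n : ℝ) / n) U (𝓝 x))
    (hK : Tendsto (fun n => (K n : ℝ) / n) U (𝓝 z)) (hxβ : x < β) (hβz : β < z)
    (hIpos : ∀ᶠ n in U, 0 < u n (I n)) (hKpos : ∀ᶠ n in U, 0 < u n (K n))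
    {A' B' : ℕ → ℝ} (hA : Tendsto A' U (𝓝 A)) (hB : Tendsto B' U (𝓝 B))
    (hA' : ∀ᶠ n in U, A' n ≤ Real.log (u n (I n)) / n)
    (hB' : ∀ᶠ n in U, B' n ≤ Real.log (u n (K n)) / n) :
    β ∈ Ioo a b ∧ ((z - β) * A + (β - x) * B) / (z - x) ≤ g β := by
  set J : ℕ → ℕ := fun n => ⌊β * (n : ℝ)⌋₊ with hJd
  have hJ : Tendsto (fun n => (J n : ℝ) / n) U (𝓝 β) :=
    ((tendsto_nat_floor_mul_div_atTop (R := ℝ) hβ0).comp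
      (tendsto_natCast_atTop_atTop (R := ℝ))).mono_left hU
  have hn0 : ∀ᶠ n : ℕ in U, (0 : ℝ) < n := by
    filter_upwards [hU (eventually_gt_atTop 0)] with n hn
    exact_mod_cast hn
  have hIJ : ∀ᶠ n in U, (I n : ℝ) / n < (J n : ℝ) / n := hI.eventually_lt hJ hxβ
  have hJK : ∀ᶠ n in U, (J n : ℝ) / n < (K n : ℝ) / n := hJ.eventually_lt hK hβz
  have hmain : ∀ᶠ n in U, 0 < u n (J n) ∧
      (((K n : ℝ) / n - (J n : ℝ) / n) * A' n + ((J n : ℝ) / n - (I n : ℝ) / n) * B' n) /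
        ((K n : ℝ) / n - (I n : ℝ) / n) ≤ Real.log (u n (J n)) / n := by
    filter_upwards [hn0, hIJ, hJK, hIpos, hKpos, hA', hB', hU h.logConcave]
      with n hn h1 h2 h3 h4 h5 h6 h7
    have h1' : I n ≤ J n := by
      rw [div_lt_div_iff_of_pos_right hn] at h1
      exact_mod_cast h1.le
    have h2' : J n ≤ K n := by
      rw [div_lt_div_iff_of_pos_right hn] at h2
      exact_mod_cast h2.le
    refine ⟨h7.pos_of_mem_Icc (h.nonneg n) h3 h4 h1' h2', ?_⟩
    rw [div_le_iff₀ (by linarith)]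
    have h8 := h7.log_chord_le (h.nonneg n) h3 h4 h1' h2'
    have h9 := mul_le_mul_of_nonneg_left h5 (sub_pos.2 h2).le
    have h10 := mul_le_mul_of_nonneg_left h6 (sub_pos.2 h1).le
    refine (add_le_add h9 h10).trans ?_
    have h11 := div_le_div_of_nonneg_right h8 (mul_pos hn hn).le
    calc _ = (((K n : ℝ) - J n) * Real.log (u n (I n)) +
          ((J n : ℝ) - I n) * Real.log (u n (K n))) / (n * n) := by field_simp
      _ ≤ _ := h11
      _ = _ := by field_simp
  have hlim : Tendsto (fun n =>
      (((K n : ℝ) / n - (J n : ℝ) / n) * A' n + ((J n : ℝ) / n - (I n : ℝ) / n) * B' n) /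
        ((K n : ℝ) / n - (I n : ℝ) / n)) U (𝓝 (((z - β) * A + (β - x) * B) / (z - x))) :=
    (((hK.sub hJ).mul hA).add ((hJ.sub hI).mul hB)).div (hK.sub hI) (by linarith)
  have hin : β ∈ Ioo a b := by
    by_contra hβ
    have hout : β ∈ Ico 0 a ∪ Ioc b 1 := by
      rw [mem_Ioo, not_and_or, not_lt, not_lt] at hβ
      rcases hβ with hβ | hβ
      · exact Or.inl ⟨hβ0, lt_of_le_of_ne hβ hβa⟩
      · exact Or.inr ⟨lt_of_le_of_ne hβ hβb.symm, hβ1⟩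
    have hC := (h.le_outside β hout (((z - β) * A + (β - x) * B) / (z - x) - 1)).filter_mono hU
    obtain ⟨n, h1, h2, h3⟩ := (hmain.and (hC.and
      (hlim.eventually_const_lt (sub_one_lt (((z - β) * A + (β - x) * B) / (z - x)))))).exists
    have := h2 h1.1
    linarith [h1.2]
  exact ⟨hin, le_of_tendsto_of_tendsto hlim ((h.tendsto_inside β hin).mono_left hU)
    (hmain.mono fun n hn => hn.2)⟩

theorem tendsto_floor (h : LogConcaveProfile u a b g) {α : ℝ} (hα : α ∈ Ioo a b) :
    Tendsto (fun n : ℕ => (⌊α * (n : ℝ)⌋₊ : ℝ) / n) atTop (𝓝 α) :=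
  (tendsto_nat_floor_mul_div_atTop (R := ℝ) (h.left_nonneg.trans hα.1.le)).comp
    (tendsto_natCast_atTop_atTop (R := ℝ))

theorem concaveOn (h : LogConcaveProfile u a b g) : ConcaveOn ℝ (Ioo a b) g := by
  refine concaveOn_of_slope_anti_adjacent (convex_Ioo a b) fun {x y z} hx hz hxy hyz => ?_
  have hy : y ∈ Ioo a b := ⟨hx.1.trans hxy, hyz.trans hz.2⟩
  have h1 := (h.chord_le le_rfl (h.left_nonneg.trans hy.1.le) (hy.2.le.trans h.right_le_one)
    hy.1.ne' hy.2.ne (h.tendsto_floor hx) (h.tendsto_floor hz) hxy hyz (h.pos_inside x hx)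
    (h.pos_inside z hz) (h.tendsto_inside x hx) (h.tendsto_inside z hz)
    (Eventually.of_forall fun _ => le_rfl) (Eventually.of_forall fun _ => le_rfl)).2
  rw [div_le_iff₀ (by linarith)] at h1
  rw [div_le_div_iff₀ (by linarith) (by linarith)]
  nlinarith

/-- No entry of the array, wherever it sits in its row, has an exponential rate above an upper
bound of the profile: otherwise the chord from a limit position of such entries to a point of
`(a, b)` would lift the profile above its bound. -/
theorem eventually_log_lt (h : LogConcaveProfile u a b g) {M c : ℝ}
    (hM : ∀ α ∈ Ioo a b, g α ≤ M) (hc : M < c) :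
    ∀ᶠ n : ℕ in atTop, ∀ k, 0 < u n k → Real.log (u n k) / n < c := by
  by_contra hcon
  have hfreq : ∃ᶠ n : ℕ in atTop, ∃ k, 0 < u n k ∧ c ≤ Real.log (u n k) / n := by
    refine (not_eventually.1 hcon).mono fun n hn => ?_
    push Not at hn
    exact hn
  have hbot : (atTop ⊓ 𝓟 {n : ℕ | ∃ k, 0 < u n k ∧ c ≤ Real.log (u n k) / n}).NeBot :=
    frequently_mem_iff_neBot.1 hfreq
  obtain ⟨U, hU'⟩ := Ultrafilter.exists_le
    (atTop ⊓ 𝓟 {n : ℕ | ∃ k, 0 < u n k ∧ c ≤ Real.log (u n k) / n})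
  have hU : (U : Filter ℕ) ≤ atTop := hU'.trans inf_le_left
  have hUmem : ∀ᶠ n in (U : Filter ℕ), ∃ k, 0 < u n k ∧ c ≤ Real.log (u n k) / n :=
    le_principal_iff.1 (hU'.trans inf_le_right)
  choose! k hk using fun n (hn : ∃ k, 0 < u n k ∧ c ≤ Real.log (u n k) / n) => hn
  have hkn : ∀ᶠ n in (U : Filter ℕ), 0 < u n (k n) ∧ c ≤ Real.log (u n (k n)) / n :=
    hUmem.mono fun n hn => hk n hn
  have hmem : ∀ᶠ n in (U : Filter ℕ), (k n : ℝ) / n ∈ Icc (0 : ℝ) 1 := by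
    filter_upwards [hkn] with n hn
    have : k n ≤ n := not_lt.1 fun hlt => hn.1.ne' (h.eq_zero n _ hlt)
    exact ⟨by positivity, div_le_one_of_le₀ (by exact_mod_cast this) (by positivity)⟩
  obtain ⟨κ, hκ, hlim⟩ := isCompact_Icc.ultrafilter_le_nhds' (U.map fun n => (k n : ℝ) / n) hmem
  have hlim' : Tendsto (fun n => (k n : ℝ) / n) (U : Filter ℕ) (𝓝 κ) := hlim
  have hcA : Tendsto (fun _ : ℕ => c) (U : Filter ℕ) (𝓝 c) := tendsto_const_nhds
  obtain ⟨α, hα, hακ⟩ : ∃ α ∈ Ioo a b, α ≠ κ := by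
    obtain ⟨α, h1, h2⟩ := exists_between h.lt
    obtain ⟨α', h3, h4⟩ := exists_between h2
    by_cases hα : α = κ
    · exact ⟨α', ⟨h1.trans h3, h4⟩, by rw [← hα]; exact h3.ne'⟩
    · exact ⟨α, ⟨h1, h2⟩, hα⟩
  have ha := h.left_nonneg
  have hb := h.right_le_one
  rcases lt_or_gt_of_ne hακ with hlt | hlt
  · have hev : ∀ᶠ β in 𝓝[<] κ, ((κ - β) * g α + (β - α) * c) / (κ - α) ≤ M := by
      have hne : ∀ᶠ β in 𝓝[<] κ, β ≠ b := by
        rcases lt_or_ge b κ with hbk | hbk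
        · filter_upwards [Ioo_mem_nhdsLT hbk] with β hβ using hβ.1.ne'
        · filter_upwards [self_mem_nhdsWithin] with β hβ using (lt_of_lt_of_le hβ hbk).ne
      filter_upwards [hne, Ioo_mem_nhdsLT hlt] with β hβb hβ
      have := h.chord_le hU (by linarith [hα.1, hβ.1]) (by linarith [hκ.2, hβ.2])
        (by linarith [hα.1, hβ.1] : a < β).ne' hβb ((h.tendsto_floor hα).mono_left hU) hlim' hβ.1
        hβ.2 (hU (h.pos_inside α hα)) (hkn.mono fun n hn => hn.1)
        ((h.tendsto_inside α hα).mono_left hU) hcA (Eventually.of_forall fun _ => le_rfl)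
        (hkn.mono fun n hn => hn.2)
      exact this.2.trans (hM β this.1)
    have hcont : Tendsto (fun β => ((κ - β) * g α + (β - α) * c) / (κ - α)) (𝓝[<] κ)
        (𝓝 (((κ - κ) * g α + (κ - α) * c) / (κ - α))) := by
      refine Tendsto.mono_left ?_ nhdsWithin_le_nhds
      exact (by fun_prop : Continuous fun β =>
        ((κ - β) * g α + (β - α) * c) / (κ - α)).tendsto κ
    have h1 := le_of_tendsto hcont hev
    rw [sub_self, zero_mul, zero_add, mul_div_cancel_left₀ _ (by linarith)] at h1
    linarith
  · have hev : ∀ᶠ β in 𝓝[>] κ, ((α - β) * c + (β - κ) * g α) / (α - κ) ≤ M := by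
      have hne : ∀ᶠ β in 𝓝[>] κ, β ≠ a := by
        rcases lt_or_ge κ a with hbk | hbk
        · filter_upwards [Ioo_mem_nhdsGT hbk] with β hβ using hβ.2.ne
        · filter_upwards [self_mem_nhdsWithin] with β hβ using (lt_of_le_of_lt hbk hβ).ne'
      filter_upwards [hne, Ioo_mem_nhdsGT hlt] with β hβa hβ
      have := h.chord_le hU (by linarith [hκ.1, hβ.1]) (by linarith [hα.2, hβ.2])
        hβa (by linarith [hα.2, hβ.2] : β < b).ne hlim' ((h.tendsto_floor hα).mono_left hU) hβ.1
        hβ.2 (hkn.mono fun n hn => hn.1) (hU (h.pos_inside α hα)) hcA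
        ((h.tendsto_inside α hα).mono_left hU) (hkn.mono fun n hn => hn.2)
        (Eventually.of_forall fun _ => le_rfl)
      exact this.2.trans (hM β this.1)
    have hcont : Tendsto (fun β => ((α - β) * c + (β - κ) * g α) / (α - κ)) (𝓝[>] κ)
        (𝓝 (((α - κ) * c + (κ - κ) * g α) / (α - κ))) := by
      refine Tendsto.mono_left ?_ nhdsWithin_le_nhds
      exact (by fun_prop : Continuous fun β =>
        ((α - β) * c + (β - κ) * g α) / (α - κ)).tendsto κ
    have h1 := le_of_tendsto hcont hev
    rw [sub_self, zero_mul, add_zero, mul_div_cancel_left₀ _ (by linarith)] at h1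
    linarith

/-- Laplace's principle: the exponential rate of the row sums is the supremum of the profile. -/
theorem tendsto_log_sum (h : LogConcaveProfile u a b g) {M : ℝ} (hM : IsLUB (g '' Ioo a b) M) :
    Tendsto (fun n : ℕ => Real.log (∑ k ∈ Finset.range (n + 1), u n k) / n) atTop (𝓝 M) := by
  have hM' : ∀ α ∈ Ioo a b, g α ≤ M := fun α hα => hM.1 (mem_image_of_mem g hα)
  have hpos : ∀ α ∈ Ioo a b, ∀ᶠ n : ℕ in atTop, 0 < u n ⌊α * (n : ℝ)⌋₊ ∧
      u n ⌊α * (n : ℝ)⌋₊ ≤ ∑ k ∈ Finset.range (n + 1), u n k := by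
    intro α hα
    filter_upwards [h.pos_inside α hα] with n hn
    refine ⟨hn, Finset.single_le_sum (f := u n) (fun k _ => h.nonneg n k) ?_⟩
    rw [Finset.mem_range, Nat.lt_succ_iff]
    exact not_lt.1 fun hlt => hn.ne' (h.eq_zero n _ hlt)
  refine tendsto_order.2 ⟨fun c hc => ?_, fun c hc => ?_⟩
  · obtain ⟨_, ⟨α, hα, rfl⟩, hcα⟩ := (lt_isLUB_iff hM).1 hc
    filter_upwards [(h.tendsto_inside α hα).eventually_const_lt hcα, hpos α hα] with n h1 h2
    exact h1.trans_le (div_le_div_of_nonneg_right (Real.log_le_log h2.1 h2.2) (by positivity))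
  · obtain ⟨d, hMd, hdc⟩ := exists_between hc
    obtain ⟨α, hα⟩ := nonempty_Ioo.2 h.lt
    have hlog : Tendsto (fun n : ℕ => Real.log ((n : ℝ) + 1) / n + d) atTop (𝓝 (0 + d)) := by
      refine Tendsto.add_const d ?_
      have h1 : Tendsto (fun x : ℝ => Real.log (x + 1) / x) atTop (𝓝 0) := by
        have h2 := (Real.tendsto_pow_log_div_mul_add_atTop 1 (-1) 1 one_ne_zero).comp
          (tendsto_atTop_add_const_right atTop (1 : ℝ) tendsto_id)
        simpa [Function.comp_def] using h2
      exact h1.comp tendsto_natCast_atTop_atTop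
    rw [zero_add] at hlog
    filter_upwards [hlog.eventually_lt_const hdc, h.eventually_log_lt hM' hMd, hpos α hα,
      eventually_gt_atTop 0] with n h1 h2 h3 hn
    refine lt_of_le_of_lt ?_ h1
    have hn' : (0 : ℝ) < n := by exact_mod_cast hn
    have h4 : ∑ k ∈ Finset.range (n + 1), u n k ≤ ((n : ℝ) + 1) * Real.exp (n * d) := by
      calc _ ≤ ∑ k ∈ Finset.range (n + 1), Real.exp (n * d) := by
            refine Finset.sum_le_sum fun k _ => ?_
            rcases (h.nonneg n k).eq_or_lt with h0 | h0
            · rw [← h0]; positivity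
            · rw [← Real.log_le_iff_le_exp h0]
              have := (div_lt_iff₀ hn').1 (h2 k h0)
              linarith
        _ = _ := by simp
    have h5 := Real.log_le_log (h3.1.trans_le h3.2) h4
    rw [Real.log_mul (by positivity) (by positivity), Real.log_exp] at h5
    rw [div_add' _ _ _ hn'.ne']
    exact div_le_div_of_nonneg_right (by linarith) hn'.le

end LogConcaveProfile

/-! ### The function `t G(t)` -/

/-- The function `t ↦ t G(t)` on `t > 0`, where `G` is the Cauchy transform. -/
def mulCauchy (μ : Measure NegHalfLine) (t : ℝ) : ℝ := t * cauchyMoment μ 1 t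

theorem mul_cauchyTransform_eqOn (μ : Measure NegHalfLine) :
    EqOn (fun t : ℝ => t * cauchyTransform μ t) (mulCauchy μ) (Ioi 0) := fun t ht => by
  simp only [mulCauchy, cauchyMoment, pow_one, cauchyTransform_eq μ ht]

theorem hasDerivAt_mulCauchy (μ : Measure NegHalfLine) [IsFiniteMeasure μ] {t : ℝ} (ht : 0 < t) :
    HasDerivAt (mulCauchy μ) (∫ z, cauchyKernel t z * (1 - t * cauchyKernel t z) ∂μ) t := by
  have hc := continuous_cauchyKernel ht
  refine ((hasDerivAt_id t).fun_mul (hasDerivAt_cauchyMoment μ 1 ht)).congr_deriv ?_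
  have h1 : Integrable (fun z => cauchyKernel t z ^ 1) μ := integrable_of_continuous μ (hc.pow 1)
  have h2 : Integrable (fun z => t * cauchyKernel t z ^ 2) μ :=
    (integrable_of_continuous μ (hc.pow 2)).const_mul t
  have h3 : ∀ z, cauchyKernel t z * (1 - t * cauchyKernel t z) =
      cauchyKernel t z ^ 1 - t * cauchyKernel t z ^ 2 := fun z => by ring
  simp only [h3]
  rw [integral_sub h1 h2, integral_const_mul]
  simp [cauchyMoment, sub_eq_add_neg]

theorem contDiffOn_mulCauchy (μ : Measure NegHalfLine) [IsFiniteMeasure μ] :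
    ContDiffOn ℝ ((⊤ : ℕ∞) : WithTop ℕ∞) (mulCauchy μ) (Ioi 0) :=
  contDiffOn_id.mul (contDiffOn_cauchyMoment μ 1)

theorem cauchyKernel_mul_one_sub_nonneg {t : ℝ} (ht : 0 < t) (z : NegHalfLine) :
    0 ≤ cauchyKernel t z * (1 - t * cauchyKernel t z) :=
  mul_nonneg (cauchyKernel_nonneg ht z) (sub_nonneg.2 (mul_cauchyKernel_le_one ht z))

theorem one_sub_mul_cauchyKernel {t : ℝ} (ht : 0 < t) (z : NegHalfLine) :
    1 - t * cauchyKernel t z = (1 - cayley z) / (1 + (t - 1) * cayley z) := by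
  have h := (one_add_mul_cayley_pos ht z).ne'
  rw [cauchyKernel, eq_div_iff h, sub_mul, one_mul, mul_assoc, div_mul_cancel₀ _ h]
  ring

theorem cauchyKernel_mul_one_sub_eq_zero_iff {t : ℝ} (ht : 0 < t) (z : NegHalfLine) :
    cauchyKernel t z * (1 - t * cauchyKernel t z) = 0 ↔ cayley z = 0 ∨ cayley z = 1 := by
  have h := (one_add_mul_cayley_pos ht z).ne'
  rw [one_sub_mul_cauchyKernel ht, mul_eq_zero, cauchyKernel, div_eq_zero_iff, div_eq_zero_iff, sub_eq_zero,
    eq_comm (a := (1 : ℝ))]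
  simp [h]

/-- The derivative of `t G(t)` vanishes at one point only if the measure is carried by
`{-∞, 0}`, and then it vanishes everywhere. -/
theorem deriv_mulCauchy_eq_zero (μ : Measure NegHalfLine) [IsFiniteMeasure μ] {t s : ℝ}
    (ht : 0 < t) (hs : 0 < s)
    (h : ∫ z, cauchyKernel t z * (1 - t * cauchyKernel t z) ∂μ = 0) :
    ∫ z, cauchyKernel s z * (1 - s * cauchyKernel s z) ∂μ = 0 := by
  have hc := continuous_cauchyKernel ht
  rw [integral_eq_zero_iff_of_nonneg (cauchyKernel_mul_one_sub_nonneg ht)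
    (integrable_of_continuous μ (hc.mul (continuous_const.sub (continuous_const.mul hc))))] at h
  refine integral_eq_zero_of_ae (h.mono fun z hz => ?_)
  exact (cauchyKernel_mul_one_sub_eq_zero_iff hs z).2
    ((cauchyKernel_mul_one_sub_eq_zero_iff ht z).1 hz)

/-- If `t G(t)` is not constant, its derivative is positive. -/
theorem deriv_mulCauchy_pos (μ : Measure NegHalfLine) [IsFiniteMeasure μ] {p q : ℝ} (hp : 0 < p)
    (hq : 0 < q) (hpq : mulCauchy μ p ≠ mulCauchy μ q) {t : ℝ} (ht : 0 < t) :
    0 < ∫ z, cauchyKernel t z * (1 - t * cauchyKernel t z) ∂μ := by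
  refine (integral_nonneg (cauchyKernel_mul_one_sub_nonneg ht)).lt_of_ne' fun h => hpq ?_
  refine (convex_Ioi (0 : ℝ)).is_const_of_fderivWithin_eq_zero (𝕜 := ℝ)
    (fun s hs => (hasDerivAt_mulCauchy μ hs).differentiableAt.differentiableWithinAt)
    (fun s hs => ?_) hp hq
  have h1 := (hasDerivAt_mulCauchy μ hs).hasFDerivAt.hasFDerivWithinAt.fderivWithin
    (isOpen_Ioi.uniqueDiffWithinAt hs)
  rw [h1, deriv_mulCauchy_eq_zero μ ht hs h]
  ext
  simp

theorem strictMonoOn_mulCauchy (μ : Measure NegHalfLine) [IsFiniteMeasure μ] {p q : ℝ}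
    (hp : 0 < p) (hq : 0 < q) (hpq : mulCauchy μ p ≠ mulCauchy μ q) :
    StrictMonoOn (mulCauchy μ) (Ioi 0) := by
  refine strictMonoOn_of_deriv_pos (convex_Ioi 0) (contDiffOn_mulCauchy μ).continuousOn
    fun t ht => ?_
  rw [interior_Ioi] at ht
  rw [(hasDerivAt_mulCauchy μ ht).deriv]
  exact deriv_mulCauchy_pos μ hp hq hpq ht

/-- If `t G(t)` is not constant, the Cauchy transform is strictly decreasing. -/
theorem strictAntiOn_cauchyMoment_one (μ : Measure NegHalfLine) [IsFiniteMeasure μ] {p q : ℝ}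
    (hp : 0 < p) (hq : 0 < q) (hpq : mulCauchy μ p ≠ mulCauchy μ q) :
    StrictAntiOn (cauchyMoment μ 1) (Ioi 0) := by
  refine strictAntiOn_of_deriv_neg (convex_Ioi 0) (contDiffOn_cauchyMoment μ 1).continuousOn
    fun t ht => ?_
  rw [interior_Ioi] at ht
  rw [(hasDerivAt_cauchyMoment μ 1 ht).deriv, Nat.cast_one, one_mul, neg_lt_zero]
  have hc := continuous_cauchyKernel ht
  refine (integral_nonneg fun z => sq_nonneg (cauchyKernel t z)).lt_of_ne' fun h => ?_
  have h0 := (integral_eq_zero_iff_of_nonneg (fun z => sq_nonneg (cauchyKernel t z))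
    (integrable_of_continuous μ (hc.pow 2))).1 h
  refine (deriv_mulCauchy_pos μ hp hq hpq ht).ne' (integral_eq_zero_of_ae (h0.mono fun z hz => ?_))
  have : cauchyKernel t z = 0 := by simpa using hz
  simp [this]

theorem cayley_eq_one_iff {z : NegHalfLine} : cayley z = 1 ↔ z = zeroPt :=
  ⟨fun h => cayley_injective (h.trans cayley_zeroPt.symm), fun h => h ▸ cayley_zeroPt⟩

theorem mulCauchy_eq_integral (μ : Measure NegHalfLine) (t : ℝ) :
    mulCauchy μ t = ∫ z, t * cauchyKernel t z ∂μ := by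
  rw [mulCauchy, cauchyMoment, integral_const_mul]
  simp

theorem norm_mul_cauchyKernel_le_one {t : ℝ} (ht : 0 < t) (z : NegHalfLine) :
    ‖t * cauchyKernel t z‖ ≤ 1 := by
  rw [Real.norm_of_nonneg (mul_nonneg ht.le (cauchyKernel_nonneg ht z))]
  exact mul_cauchyKernel_le_one ht z

theorem tendsto_mulCauchy_zero (μ : Measure NegHalfLine) [IsFiniteMeasure μ] :
    Tendsto (mulCauchy μ) (𝓝[>] 0) (𝓝 (μ.real {zeroPt})) := by
  have hlim : ∫ z, ({zeroPt} : Set NegHalfLine).indicator (fun _ => (1 : ℝ)) z ∂μ =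
      μ.real {zeroPt} := by
    rw [integral_indicator (measurableSet_singleton _)]
    simp [measureReal_def]
  rw [← hlim, funext (mulCauchy_eq_integral μ)]
  refine tendsto_integral_filter_of_dominated_convergence (fun _ => (1 : ℝ)) ?_ ?_
    (integrable_const _) (ae_of_all _ fun z => ?_)
  · filter_upwards [self_mem_nhdsWithin] with t ht
    exact (continuous_const.mul (continuous_cauchyKernel ht)).aestronglyMeasurable
  · filter_upwards [self_mem_nhdsWithin] with t ht
    exact ae_of_all _ (norm_mul_cauchyKernel_le_one ht)
  · by_cases hz : z = zeroPt
    · rw [indicator_of_mem (mem_singleton_iff.2 hz)]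
      refine tendsto_const_nhds.congr' ?_
      filter_upwards [self_mem_nhdsWithin] with t ht
      have : t ≠ 0 := ne_of_gt ht
      rw [cauchyKernel, cayley_eq_one_iff.2 hz, mul_one, add_sub_cancel, mul_one_div_cancel this]
    · rw [indicator_of_notMem (by simpa using hz)]
      have h1 : 1 + (0 - 1) * cayley z ≠ 0 := by
        intro h
        exact hz (cayley_eq_one_iff.1 (by linarith))
      have h2 : ContinuousAt (fun t : ℝ => t * (cayley z / (1 + (t - 1) * cayley z))) 0 := by
        fun_prop (disch := exact h1)
      have h3 := h2.tendsto
      rw [zero_mul] at h3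
      exact h3.mono_left nhdsWithin_le_nhds

theorem tendsto_mulCauchy_atTop (μ : Measure NegHalfLine) [IsProbabilityMeasure μ] :
    Tendsto (mulCauchy μ) atTop (𝓝 (1 - μ.real {negInfty})) := by
  have hlim : ∫ z, ({negInfty}ᶜ : Set NegHalfLine).indicator (fun _ => (1 : ℝ)) z ∂μ =
      1 - μ.real {negInfty} := by
    rw [integral_indicator (measurableSet_singleton _).compl]
    simp [probReal_compl_eq_one_sub (measurableSet_singleton negInfty)]
  rw [← hlim, funext (mulCauchy_eq_integral μ)]
  refine tendsto_integral_filter_of_dominated_convergence (fun _ => (1 : ℝ)) ?_ ?_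
    (integrable_const _) (ae_of_all _ fun z => ?_)
  · filter_upwards [eventually_gt_atTop 0] with t ht
    exact (continuous_const.mul (continuous_cauchyKernel ht)).aestronglyMeasurable
  · filter_upwards [eventually_gt_atTop 0] with t ht
    exact ae_of_all _ (norm_mul_cauchyKernel_le_one ht)
  · by_cases hz : z = negInfty
    · rw [indicator_of_notMem (by simpa using hz)]
      simp [cauchyKernel, hz, cayley_negInfty]
    · rw [indicator_of_mem (by simpa using hz)]
      have hc := cayley_pos hz
      have h1 : Tendsto (fun t : ℝ => 1 + (t - 1) * cayley z) atTop atTop :=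
        tendsto_atTop_add_const_left _ _
          ((tendsto_atTop_add_const_right _ (-1) tendsto_id).atTop_mul_const hc)
      have h2 := (tendsto_const_nhds (x := (1 : ℝ))).sub
        ((tendsto_const_nhds (x := 1 - cayley z)).div_atTop h1)
      rw [sub_zero] at h2
      refine h2.congr' ?_
      filter_upwards [eventually_gt_atTop 0] with t ht
      linarith [one_sub_mul_cauchyKernel ht z]

/-! ### Concave functions and their conjugates -/

/-- A concave function on an open interval has a supporting line at each point; `-s` is its
slope. -/
theorem ConcaveOn.exists_forall_add_mul_le {a b : ℝ} {g : ℝ → ℝ} (hg : ConcaveOn ℝ (Ioo a b) g)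
    {α : ℝ} (hα : α ∈ Ioo a b) : ∃ s : ℝ, ∀ β ∈ Ioo a b, g β + β * s ≤ g α + α * s := by
  have hc := hg.neg
  have hint : α ∈ interior (Ioo a b) := by rwa [interior_Ioo]
  refine ⟨derivWithin (-g) (Ioi α) α, fun β hβ => ?_⟩
  rcases lt_trichotomy β α with h | rfl | h
  · have h1 := hc.slope_le_leftDeriv_of_mem_interior hβ hint h
    have h2 := hc.leftDeriv_le_rightDeriv_of_mem_interior hint
    have h3 := h1.trans h2
    rw [slope_def_field, div_le_iff₀ (by linarith)] at h3
    simp only [Pi.neg_apply] at h3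
    linarith
  · exact le_rfl
  · have h1 := hc.rightDeriv_le_slope_of_mem_interior hint hβ h
    rw [slope_def_field, le_div_iff₀ (by linarith)] at h1
    simp only [Pi.neg_apply] at h1
    linarith

theorem ConcaveOn.bddAbove_image_add_mul {a b : ℝ} {g : ℝ → ℝ} (hg : ConcaveOn ℝ (Ioo a b) g)
    (hab : a < b) (s : ℝ) : BddAbove ((fun α => g α + α * s) '' Ioo a b) := by
  obtain ⟨α, hα⟩ := nonempty_Ioo.2 hab
  obtain ⟨r, hr⟩ := hg.exists_forall_add_mul_le hα
  refine ⟨g α + α * r + max (a * (s - r)) (b * (s - r)), ?_⟩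
  rintro _ ⟨β, hβ, rfl⟩
  have h1 := hr β hβ
  have h2 : β * (s - r) ≤ max (a * (s - r)) (b * (s - r)) := by
    rcases le_total 0 (s - r) with h | h
    · exact (mul_le_mul_of_nonneg_right hβ.2.le h).trans (le_max_right _ _)
    · exact (mul_le_mul_of_nonpos_right hβ.1.le h).trans (le_max_left _ _)
  simp only
  linarith

/-- The analytic link between the profile `g` and the limit measure `μ`: `g` is concave, and up to
an additive constant `u ↦ logPotential μ (exp u)` is the conjugate
`u ↦ sup_α (g α + α u)`. -/
structure IsConjugatePotential (μ : Measure NegHalfLine) (a b : ℝ) (g : ℝ → ℝ) (M : ℝ) :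
    Prop where
  left_nonneg : 0 ≤ a
  lt : a < b
  concaveOn : ConcaveOn ℝ (Ioo a b) g
  isLUB : ∀ s : ℝ, IsLUB ((fun α => g α + α * s) '' Ioo a b) (logPotential μ (Real.exp s) + M)

namespace IsConjugatePotential

variable {μ : Measure NegHalfLine} {a b : ℝ} {g : ℝ → ℝ} {M : ℝ}

theorem add_mul_le (h : IsConjugatePotential μ a b g M) {α : ℝ} (hα : α ∈ Ioo a b) (s : ℝ) :
    g α + α * s ≤ logPotential μ (Real.exp s) + M :=
  (h.isLUB s).1 (mem_image_of_mem _ hα)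

theorem exists_eq (h : IsConjugatePotential μ a b g M) {α : ℝ} (hα : α ∈ Ioo a b) :
    ∃ s, g α + α * s = logPotential μ (Real.exp s) + M := by
  obtain ⟨s, hs⟩ := h.concaveOn.exists_forall_add_mul_le hα
  refine ⟨s, le_antisymm (h.add_mul_le hα s) ((h.isLUB s).2 ?_)⟩
  rintro _ ⟨β, hβ, rfl⟩
  exact hs β hβ

/-- Biconjugation: `-g + M` is the Legendre transform of the potential in the variable `log t`. -/
theorem isLUB_legendre (h : IsConjugatePotential μ a b g M) {α : ℝ} (hα : α ∈ Ioo a b) :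
    IsLUB (range fun u : ℝ => α * u - logPotential μ (Real.exp u)) (-g α + M) := by
  obtain ⟨s, hs⟩ := h.exists_eq hα
  refine IsGreatest.isLUB ⟨⟨s, by simp only; linarith⟩, ?_⟩
  rintro _ ⟨u, rfl⟩
  have := h.add_mul_le hα u
  simp only
  linarith

variable [IsProbabilityMeasure μ]

theorem hasDerivAt_logPotential_exp (μ : Measure NegHalfLine) [IsProbabilityMeasure μ] (s : ℝ) :
    HasDerivAt (fun s => logPotential μ (Real.exp s)) (mulCauchy μ (Real.exp s)) s := by
  refine ((hasDerivAt_logPotential μ (Real.exp_pos s)).comp s (Real.hasDerivAt_exp s)).congr_deriv ?_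
  rw [mulCauchy, mul_comm]

/-- At a point where Young's inequality is an equality, the slope of the potential is `α`. -/
theorem mulCauchy_eq (h : IsConjugatePotential μ a b g M) {α s : ℝ} (hα : α ∈ Ioo a b)
    (hs : g α + α * s = logPotential μ (Real.exp s) + M) : mulCauchy μ (Real.exp s) = α := by
  have hd : HasDerivAt (fun v => logPotential μ (Real.exp v) - α * v)
      (mulCauchy μ (Real.exp s) - α * 1) s :=
    (hasDerivAt_logPotential_exp μ s).sub ((hasDerivAt_id s).const_mul α)
  have hmin : IsLocalMin (fun v => logPotential μ (Real.exp v) - α * v) s :=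
    Eventually.of_forall fun v => by
      have := h.add_mul_le hα v
      simp only
      linarith
  linarith [hmin.hasDerivAt_eq_zero hd]

theorem exists_mulCauchy_eq (h : IsConjugatePotential μ a b g M) {α : ℝ} (hα : α ∈ Ioo a b) :
    ∃ t, 0 < t ∧ mulCauchy μ t = α ∧ g α + α * Real.log t = logPotential μ t + M := by
  obtain ⟨s, hs⟩ := h.exists_eq hα
  refine ⟨Real.exp s, Real.exp_pos s, h.mulCauchy_eq hα hs, ?_⟩
  rwa [Real.log_exp]

/-- The function `t G(t)` is not constant, since its image contains the interval `(a, b)`. -/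
theorem exists_mulCauchy_ne (h : IsConjugatePotential μ a b g M) :
    ∃ p q, 0 < p ∧ 0 < q ∧ mulCauchy μ p ≠ mulCauchy μ q := by
  obtain ⟨α, hα⟩ := exists_between h.lt
  obtain ⟨β, hβ⟩ := exists_between hα.2
  obtain ⟨p, hp, hp', -⟩ := h.exists_mulCauchy_eq hα
  obtain ⟨q, hq, hq', -⟩ := h.exists_mulCauchy_eq (α := β) ⟨hα.1.trans hβ.1, hβ.2⟩
  exact ⟨p, q, hp, hq, by rw [hp', hq']; exact hβ.1.ne⟩

theorem strictMonoOn (h : IsConjugatePotential μ a b g M) : StrictMonoOn (mulCauchy μ) (Ioi 0) := by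
  obtain ⟨p, q, hp, hq, hpq⟩ := h.exists_mulCauchy_ne
  exact strictMonoOn_mulCauchy μ hp hq hpq

theorem mulCauchy_mem_Icc (h : IsConjugatePotential μ a b g M) {t : ℝ} (ht : 0 < t) :
    mulCauchy μ t ∈ Icc a b := by
  have hd := hasDerivAt_logPotential_exp μ (Real.log t)
  rw [Real.exp_log ht] at hd
  constructor
  · have hmono : Monotone fun s => logPotential μ (Real.exp s) - a * s := by
      intro s v hsv
      have : logPotential μ (Real.exp s) + M ≤ logPotential μ (Real.exp v) + M - a * (v - s) := by
        refine (h.isLUB s).2 ?_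
        rintro _ ⟨α, hα, rfl⟩
        have h1 := h.add_mul_le hα v
        have h2 := mul_le_mul_of_nonneg_right hα.1.le (sub_nonneg.2 hsv)
        simp only
        linarith
      simp only
      linarith
    have h1 : HasDerivAt (fun s => logPotential μ (Real.exp s) - a * s) (mulCauchy μ t - a * 1)
        (Real.log t) := hd.sub ((hasDerivAt_id _).const_mul a)
    have h2 := hmono.deriv_nonneg (x := Real.log t)
    rw [h1.deriv] at h2
    linarith
  · have hanti : Antitone fun s => logPotential μ (Real.exp s) - b * s := by
      intro s v hsv
      have : logPotential μ (Real.exp v) + M ≤ logPotential μ (Real.exp s) + M + b * (v - s) := by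
        refine (h.isLUB v).2 ?_
        rintro _ ⟨α, hα, rfl⟩
        have h1 := h.add_mul_le hα s
        have h2 := mul_le_mul_of_nonneg_right hα.2.le (sub_nonneg.2 hsv)
        simp only
        linarith
      simp only
      linarith
    have h1 : HasDerivAt (fun s => logPotential μ (Real.exp s) - b * s) (mulCauchy μ t - b * 1)
        (Real.log t) := hd.sub ((hasDerivAt_id _).const_mul b)
    have h2 := hanti.deriv_nonpos (x := Real.log t)
    rw [h1.deriv] at h2
    linarith

theorem mulCauchy_mem_Ioo (h : IsConjugatePotential μ a b g M) {t : ℝ} (ht : 0 < t) :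
    mulCauchy μ t ∈ Ioo a b := by
  have ht2 : 0 < t / 2 := by linarith
  have h2t : 0 < 2 * t := by linarith
  exact ⟨(h.mulCauchy_mem_Icc ht2).1.trans_lt (h.strictMonoOn ht2 ht (by linarith)),
    (h.strictMonoOn ht h2t (by linarith)).trans_le (h.mulCauchy_mem_Icc h2t).2⟩

theorem bijOn (h : IsConjugatePotential μ a b g M) : BijOn (mulCauchy μ) (Ioi 0) (Ioo a b) :=
  ⟨fun _ ht => h.mulCauchy_mem_Ioo ht, h.strictMonoOn.injOn, fun _ hα =>
    let ⟨t, ht, hta, _⟩ := h.exists_mulCauchy_eq hα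
    ⟨t, ht, hta⟩⟩

theorem eq_logPotential (h : IsConjugatePotential μ a b g M) {t : ℝ} (ht : 0 < t) :
    g (mulCauchy μ t) = logPotential μ t + M - mulCauchy μ t * Real.log t := by
  obtain ⟨s, hs, hst, hgs⟩ := h.exists_mulCauchy_eq (h.mulCauchy_mem_Ioo ht)
  have : s = t := h.strictMonoOn.injOn hs ht hst
  subst this
  linarith

theorem contDiffOn_logPotential (μ : Measure NegHalfLine) [IsFiniteMeasure μ] :
    ContDiffOn ℝ ((⊤ : ℕ∞) : WithTop ℕ∞) (logPotential μ) (Ioi 0) := by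
  rw [contDiffOn_infty_iff_deriv_of_isOpen isOpen_Ioi]
  exact ⟨fun t ht => (hasDerivAt_logPotential μ ht).differentiableAt.differentiableWithinAt,
    (contDiffOn_cauchyMoment μ 1).congr fun t ht => (hasDerivAt_logPotential μ ht).deriv⟩

/-- The profile is smooth: near `α = t G(t)` it is a smooth function of the local inverse of
`t ↦ t G(t)`. -/
theorem contDiffAt (h : IsConjugatePotential μ a b g M) {α : ℝ} (hα : α ∈ Ioo a b) :
    ContDiffAt ℝ ((⊤ : ℕ∞) : WithTop ℕ∞) g α := by
  obtain ⟨t, ht, rfl, -⟩ := h.exists_mulCauchy_eq hα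
  obtain ⟨p, q, hp, hq, hpq⟩ := h.exists_mulCauchy_ne
  have hpos := deriv_mulCauchy_pos μ hp hq hpq ht
  have hT : ContDiffAt ℝ ((⊤ : ℕ∞) : WithTop ℕ∞) (mulCauchy μ) t :=
    (contDiffOn_mulCauchy μ).contDiffAt (Ioi_mem_nhds ht)
  have hT' := (hasDerivAt_mulCauchy μ ht).hasFDerivAt_equiv hpos.ne'
  have hn : ((⊤ : ℕ∞) : WithTop ℕ∞) ≠ 0 := by simp
  set ψ := hT.localInverse hT' hn with hψ
  have hψ1 : ContDiffAt ℝ ((⊤ : ℕ∞) : WithTop ℕ∞) ψ (mulCauchy μ t) := hT.to_localInverse hT' hn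
  have hψ2 : ψ (mulCauchy μ t) = t := hT.localInverse_apply_image hT' hn
  have hψ3 : ∀ᶠ x in 𝓝 (mulCauchy μ t), mulCauchy μ (ψ x) = x :=
    (hT.hasStrictFDerivAt' hT' hn).eventually_right_inverse
  have hψ4 : ∀ᶠ x in 𝓝 (mulCauchy μ t), 0 < ψ x := by
    refine hψ1.continuousAt.eventually_const_lt ?_
    rwa [hψ2]
  have hL : ContDiffAt ℝ ((⊤ : ℕ∞) : WithTop ℕ∞) (logPotential μ) (ψ (mulCauchy μ t)) := by
    rw [hψ2]
    exact (contDiffOn_logPotential μ).contDiffAt (Ioi_mem_nhds ht)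
  have hsm : ContDiffAt ℝ ((⊤ : ℕ∞) : WithTop ℕ∞)
      (fun x => logPotential μ (ψ x) + M - x * Real.log (ψ x)) (mulCauchy μ t) :=
    ((hL.comp _ hψ1).add contDiffAt_const).sub
      (contDiffAt_id.mul (hψ1.log (by rw [hψ2]; exact ht.ne')))
  refine hsm.congr_of_eventuallyEq ?_
  filter_upwards [hψ3, hψ4] with x h1 h2
  have := h.eq_logPotential h2
  rwa [h1] at this

/-- The slope of the profile at `t G(t)` is `-log t`, by the envelope argument: `β ↦ g β + β log t`
is maximal at `t G(t)`. -/
theorem hasDerivAt (h : IsConjugatePotential μ a b g M) {t : ℝ} (ht : 0 < t) :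
    HasDerivAt g (-Real.log t) (mulCauchy μ t) := by
  have hmem := h.mulCauchy_mem_Ioo ht
  have hd := ((h.contDiffAt hmem).differentiableAt (by simp)).hasDerivAt
  have hmax : IsLocalMax (fun β => g β + β * Real.log t) (mulCauchy μ t) := by
    filter_upwards [isOpen_Ioo.mem_nhds hmem] with β hβ
    have h1 := h.add_mul_le hβ (Real.log t)
    have h2 := h.eq_logPotential ht
    rw [Real.exp_log ht] at h1
    linarith
  have h0 := hmax.hasDerivAt_eq_zero (hd.add ((hasDerivAt_id _).mul_const (Real.log t)))
  exact hd.congr_deriv (by linarith)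

theorem exp_neg_deriv (h : IsConjugatePotential μ a b g M) {t : ℝ} (ht : 0 < t) :
    Real.exp (-deriv g (mulCauchy μ t)) = t := by
  rw [(h.hasDerivAt ht).deriv, neg_neg, Real.exp_log ht]

theorem invOn (h : IsConjugatePotential μ a b g M) :
    InvOn (mulCauchy μ) (fun α : ℝ => Real.exp (-deriv g α)) (Ioo a b) (Ioi 0) := by
  refine ⟨fun α hα => ?_, fun t ht => h.exp_neg_deriv ht⟩
  obtain ⟨t, ht, rfl, -⟩ := h.exists_mulCauchy_eq hα
  exact congrArg (mulCauchy μ) (h.exp_neg_deriv ht)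

theorem contDiffOn (h : IsConjugatePotential μ a b g M) :
    ContDiffOn ℝ ((⊤ : ℕ∞) : WithTop ℕ∞) g (Ioo a b) :=
  fun _ hα => (h.contDiffAt hα).contDiffWithinAt

theorem strictConcaveOn (h : IsConjugatePotential μ a b g M) : StrictConcaveOn ℝ (Ioo a b) g := by
  refine StrictAntiOn.strictConcaveOn_of_deriv (convex_Ioo a b) h.contDiffOn.continuousOn ?_
  rw [interior_Ioo]
  intro α hα β hβ hαβ
  obtain ⟨t, ht, rfl, -⟩ := h.exists_mulCauchy_eq hα
  obtain ⟨s, hs, rfl, -⟩ := h.exists_mulCauchy_eq hβ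
  rw [(h.hasDerivAt ht).deriv, (h.hasDerivAt hs).deriv, neg_lt_neg_iff]
  exact Real.log_lt_log ht ((h.strictMonoOn.lt_iff_lt ht hs).1 hαβ)

/-- The derivative of `g α + α log α` at `α = t G(t)` is `log G(t) + 1`, which decreases in `t`. -/
theorem strictConcaveOn_add_mul_log (h : IsConjugatePotential μ a b g M) :
    StrictConcaveOn ℝ (Ioo a b) fun α => g α + α * Real.log α := by
  obtain ⟨p, q, hp, hq, hpq⟩ := h.exists_mulCauchy_ne
  have hpos : ∀ t, 0 < t → 0 < cauchyMoment μ 1 t := fun t ht =>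
    (pos_iff_pos_of_mul_pos (h.left_nonneg.trans_lt (h.mulCauchy_mem_Ioo ht).1)).1 ht
  have hder : ∀ t, 0 < t → HasDerivAt (fun α => g α + α * Real.log α)
      (Real.log (cauchyMoment μ 1 t) + 1) (mulCauchy μ t) := by
    intro t ht
    have h1 : mulCauchy μ t ≠ 0 := (mul_pos ht (hpos t ht)).ne'
    refine ((h.hasDerivAt ht).add (Real.hasDerivAt_mul_log h1)).congr_deriv ?_
    rw [mulCauchy, Real.log_mul ht.ne' (hpos t ht).ne']
    ring
  refine StrictAntiOn.strictConcaveOn_of_deriv (convex_Ioo a b) (fun α hα => ?_) ?_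
  · obtain ⟨t, ht, rfl, -⟩ := h.exists_mulCauchy_eq hα
    exact (hder t ht).continuousAt.continuousWithinAt
  rw [interior_Ioo]
  intro α hα β hβ hαβ
  obtain ⟨t, ht, rfl, -⟩ := h.exists_mulCauchy_eq hα
  obtain ⟨s, hs, rfl, -⟩ := h.exists_mulCauchy_eq hβ
  rw [(hder t ht).deriv, (hder s hs).deriv]
  have h1 := strictAntiOn_cauchyMoment_one μ hp hq hpq ht hs
    ((h.strictMonoOn.lt_iff_lt ht hs).1 hαβ)
  have := Real.log_lt_log (hpos s hs) h1
  linarith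

theorem real_zeroPt (h : IsConjugatePotential μ a b g M) : μ.real {zeroPt} = a := by
  refine tendsto_nhds_unique (tendsto_mulCauchy_zero μ) (tendsto_order.2 ⟨fun c hc => ?_,
    fun c hc => ?_⟩)
  · filter_upwards [self_mem_nhdsWithin] with t ht using hc.trans (h.mulCauchy_mem_Ioo ht).1
  · obtain ⟨α, h1, h2⟩ := exists_between (lt_min hc h.lt)
    obtain ⟨t, ht, rfl, -⟩ := h.exists_mulCauchy_eq ⟨h1, h2.trans_le (min_le_right _ _)⟩
    filter_upwards [Ioo_mem_nhdsGT ht] with s hs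
    exact (h.strictMonoOn hs.1 ht hs.2).trans (h2.trans_le (min_le_left _ _))

theorem real_negInfty (h : IsConjugatePotential μ a b g M) : μ.real {negInfty} = 1 - b := by
  have hlim : Tendsto (mulCauchy μ) atTop (𝓝 b) := by
    refine tendsto_order.2 ⟨fun c hc => ?_, fun c hc => ?_⟩
    · obtain ⟨α, h1, h2⟩ := exists_between (max_lt hc h.lt)
      obtain ⟨t, ht, rfl, -⟩ := h.exists_mulCauchy_eq ⟨(le_max_right _ _).trans_lt h1, h2⟩
      filter_upwards [eventually_gt_atTop t] with s hs
      exact ((le_max_left _ _).trans_lt h1).trans (h.strictMonoOn ht (ht.trans hs) hs)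
    · filter_upwards [eventually_gt_atTop 0] with t ht
      exact (h.mulCauchy_mem_Ioo ht).2.trans hc
  linarith [tendsto_nhds_unique (tendsto_mulCauchy_atTop μ) hlim]

end IsConjugatePotential

/-! ### Convergence of the empirical distributions -/

theorem tendsto_logPotential {U : Filter ℕ} {ν : ℕ → ProbabilityMeasure NegHalfLine}
    {μ : ProbabilityMeasure NegHalfLine} (h : Tendsto ν U (𝓝 μ)) {t : ℝ} (ht : 0 < t) :
    Tendsto (fun n => logPotential (ν n) t) U (𝓝 (logPotential μ t)) := by
  simp only [logPotential_eq]
  exact ProbabilityMeasure.tendsto_iff_forall_integral_tendsto.1 h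
    (BoundedContinuousFunction.mkOfCompact ⟨_, continuous_log_one_add_mul_cayley ht⟩)

/-- The logarithmic potential determines the measure. -/
theorem eq_of_logPotential_eqOn {μ ν : ProbabilityMeasure NegHalfLine}
    (h : ∀ t : ℝ, 0 < t → logPotential μ t = logPotential ν t) : μ = ν := by
  refine eq_of_cauchyMoment_one_eqOn μ ν fun t ht => ?_
  have h1 := hasDerivAt_logPotential (μ : Measure NegHalfLine) ht
  refine (h1.congr_of_eventuallyEq ?_).unique (hasDerivAt_logPotential (ν : Measure NegHalfLine) ht)
  filter_upwards [Ioi_mem_nhds ht] with s hs using (h s hs).symm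

/-- By compactness of the space of probability measures on `[-∞, 0]`, pointwise convergence of the
logarithmic potentials implies weak convergence. -/
theorem exists_tendsto_of_tendsto_logPotential {ν : ℕ → ProbabilityMeasure NegHalfLine} {f : ℝ → ℝ}
    (h : ∀ t : ℝ, 0 < t → Tendsto (fun n => logPotential (ν n) t) atTop (𝓝 (f t))) :
    ∃ μ : ProbabilityMeasure NegHalfLine, Tendsto ν atTop (𝓝 μ) ∧
      ∀ t : ℝ, 0 < t → logPotential μ t = f t := by
  have key : ∀ U : Ultrafilter ℕ, (U : Filter ℕ) ≤ atTop →
      ∃ μ : ProbabilityMeasure NegHalfLine, Tendsto ν U (𝓝 μ) ∧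
        ∀ t : ℝ, 0 < t → logPotential μ t = f t := by
    intro U hU
    obtain ⟨μ, -, hμ⟩ := isCompact_univ.ultrafilter_le_nhds' (U.map ν) univ_mem
    exact ⟨μ, hμ, fun t ht =>
      tendsto_nhds_unique (tendsto_logPotential (U := U) hμ ht) ((h t ht).mono_left hU)⟩
  obtain ⟨U, hU⟩ := Ultrafilter.exists_le (atTop : Filter ℕ)
  obtain ⟨μ, -, hμ⟩ := key U hU
  refine ⟨μ, (tendsto_iff_ultrafilter _ _ _).2 fun V hV => ?_, hμ⟩
  obtain ⟨μ', hμ', h'⟩ := key V hV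
  rwa [eq_of_logPotential_eqOn fun t ht => (hμ t ht).trans (h' t ht).symm]

/-- The empirical distribution of zeros on `[-∞, 0]` as a probability measure, with an arbitrary
value when `n = 0` or `n < deg P`. -/
def halfLineZerosProb (n : ℕ) (P : Polynomial ℝ) : ProbabilityMeasure NegHalfLine :=
  open Classical in
  if h : IsProbabilityMeasure (halfLineZeros n P) then
    (⟨halfLineZeros n P, h⟩ : ProbabilityMeasure NegHalfLine)
  else (⟨Measure.dirac zeroPt, inferInstance⟩ : ProbabilityMeasure NegHalfLine)

theorem coe_halfLineZerosProb {n : ℕ} (hn : n ≠ 0) {P : Polynomial ℝ} (hP : P.natDegree ≤ n) :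
    (halfLineZerosProb n P : Measure NegHalfLine) = halfLineZeros n P := by
  have h := isProbabilityMeasure_halfLineZeros hn hP
  have h1 : halfLineZerosProb n P = (⟨halfLineZeros n P, h⟩ : ProbabilityMeasure NegHalfLine) :=
    dif_pos h
  rw [h1]
  rfl

/-- The exponential rate of `P n` at `exp s` is the conjugate of the profile. -/
theorem HasExponentialProfile.tendsto_log_eval {P : ℕ → Polynomial ℝ} {a b : ℝ} {g : ℝ → ℝ}
    (hg : HasExponentialProfile P a b g) (hroots : ∀ᶠ n in atTop, HasOnlyNonposRoots (P n))
    (s : ℝ) {M : ℝ} (hM : IsLUB ((fun α => g α + α * s) '' Ioo a b) M) :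
    Tendsto (fun n : ℕ => Real.log ((P n).eval (Real.exp s)) / n) atTop (𝓝 M) := by
  refine (((hg.logConcaveProfile hroots).tilt s).tendsto_log_sum hM).congr fun n => ?_
  rw [Polynomial.eval_eq_sum_range' (Nat.lt_succ_of_le (hg.natDegree_le n))]

end

theorem mainTheorem1 (P : ℕ → Polynomial ℝ) (hP : ∀ n, P n ≠ 0) (a b : ℝ) (g : ℝ → ℝ)
    (hg : HasExponentialProfile P a b g)
    (hroots : ∀ᶠ n in Filter.atTop, HasOnlyNonposRoots (P n)) :
    ∃ μ : MeasureTheory.ProbabilityMeasure NegHalfLine,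
      -- weak convergence of the empirical distributions, viewed on `[-∞, 0]` for large `n`
      (∃ ν : ℕ → MeasureTheory.ProbabilityMeasure NegHalfLine,
        (∀ᶠ n in Filter.atTop,
          MeasureTheory.Measure.map toSphere (ν n : MeasureTheory.Measure NegHalfLine) =
            empiricalZeros n (P n)) ∧
        Filter.Tendsto ν Filter.atTop (nhds μ)) ∧
      -- the Cauchy transform
      Set.InvOn (fun t : ℝ => t * cauchyTransform μ t) (fun α : ℝ => Real.exp (-deriv g α))
        (Set.Ioo a b) (Set.Ioi 0) ∧
      StrictMonoOn (fun t : ℝ => t * cauchyTransform μ t) (Set.Ioi 0) ∧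
      ContinuousOn (fun t : ℝ => t * cauchyTransform μ t) (Set.Ioi 0) ∧
      Set.BijOn (fun t : ℝ => t * cauchyTransform μ t) (Set.Ioi 0) (Set.Ioo a b) ∧
      -- these relations determine the measure
      (∀ μ' : MeasureTheory.ProbabilityMeasure NegHalfLine,
        Set.InvOn (fun t : ℝ => t * cauchyTransform μ' t) (fun α : ℝ => Real.exp (-deriv g α))
          (Set.Ioo a b) (Set.Ioi 0) → μ' = μ) ∧
      -- growth of `P n` at `1`, and the Legendre transform
      (∃ M : ℝ, IsLUB (g '' Set.Ioo a b) M ∧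
        Filter.Tendsto (fun n : ℕ => Real.log ((P n).eval 1) / (n : ℝ)) Filter.atTop (nhds M) ∧
        ∀ α ∈ Set.Ioo a b,
          IsLUB (Set.range fun u : ℝ => α * u - logPotential μ (Real.exp u)) (-g α + M)) ∧
      -- regularity and concavity
      ContDiffOn ℝ ((⊤ : ℕ∞) : WithTop ℕ∞) g (Set.Ioo a b) ∧
      StrictConcaveOn ℝ (Set.Ioo a b) g ∧
      StrictConcaveOn ℝ (Set.Ioo a b) (fun α => g α + α * Real.log α) ∧
      -- atoms at the end points
      (μ : MeasureTheory.Measure NegHalfLine).real {zeroPt} = a ∧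
      (μ : MeasureTheory.Measure NegHalfLine).real {negInfty} = 1 - b := by
  have hconc := (hg.logConcaveProfile hroots).concaveOn
  have hf : ∀ s : ℝ, IsLUB ((fun α => g α + α * s) '' Set.Ioo a b)
      (sSup ((fun α => g α + α * s) '' Set.Ioo a b)) := fun s =>
    isLUB_csSup ((Set.nonempty_Ioo.2 hg.lt).image _) (hconc.bddAbove_image_add_mul hg.lt s)
  set f : ℝ → ℝ := fun s => sSup ((fun α => g α + α * s) '' Set.Ioo a b) with hfd
  have hlim : ∀ s, Tendsto (fun n : ℕ => Real.log ((P n).eval (Real.exp s)) / n) atTop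
      (nhds (f s)) := fun s => hg.tendsto_log_eval hroots s (hf s)
  have hlim0 : Tendsto (fun n : ℕ => Real.log ((P n).eval 1) / (n : ℝ)) atTop (nhds (f 0)) := by
    simpa using hlim 0
  have hpot : ∀ t : ℝ, 0 < t → Tendsto (fun n => logPotential (halfLineZerosProb n (P n)) t)
      atTop (nhds (f (Real.log t) - f 0)) := by
    intro t ht
    have h1 := (hlim (Real.log t)).sub hlim0
    rw [Real.exp_log ht] at h1
    refine h1.congr' ?_
    filter_upwards [hroots, eventually_ne_atTop 0] with n hn hn0
    rw [coe_halfLineZerosProb hn0 (hg.natDegree_le n), hn.logPotential_halfLineZeros (hP n) hn0 ht]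
    ring
  obtain ⟨μ, hμ, hμf⟩ := exists_tendsto_of_tendsto_logPotential hpot
  have hconj : IsConjugatePotential μ a b g (f 0) :=
    ⟨hg.left_nonneg, hg.lt, hconc, fun s => by
      rw [hμf _ (Real.exp_pos s), Real.log_exp, sub_add_cancel]
      exact hf s⟩
  have heq := mul_cauchyTransform_eqOn (μ : Measure NegHalfLine)
  refine ⟨μ, ⟨fun n => halfLineZerosProb n (P n), ?_, hμ⟩, ?_, hconj.strictMonoOn.congr heq.symm,
    (contDiffOn_mulCauchy (μ : Measure NegHalfLine)).continuousOn.congr heq,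
    hconj.bijOn.congr heq.symm, fun μ' hμ' => ?_, ⟨f 0, ?_, hlim0, fun α hα =>
    hconj.isLUB_legendre hα⟩, hconj.contDiffOn, hconj.strictConcaveOn,
    hconj.strictConcaveOn_add_mul_log, hconj.real_zeroPt, hconj.real_negInfty⟩
  · filter_upwards [hroots, eventually_ne_atTop 0] with n hn hn0
    rw [coe_halfLineZerosProb hn0 (hg.natDegree_le n), hn.map_toSphere_halfLineZeros]
  · exact ⟨fun α hα => (heq (Real.exp_pos _)).trans (hconj.invOn.1 hα), fun t ht => by
      rw [heq ht]
      exact hconj.invOn.2 ht⟩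
  · refine eq_of_cauchyMoment_one_eqOn μ' μ fun t ht => mul_left_cancel₀ (ne_of_gt ht) ?_
    -- `α = t G_μ(t)` satisfies `exp (-g' α) = t`, and `μ'` inverts this relation as well
    have h1 := hμ'.1 (hconj.mulCauchy_mem_Ioo ht)
    have h2 := hconj.exp_neg_deriv ht
    simp only [h2] at h1
    exact (mul_cauchyTransform_eqOn (μ' : Measure NegHalfLine) ht).symm.trans h1
  · have h0 := hf 0
    simp only [mul_zero, add_zero] at h0
    rw [hfd]
    simpa only [mul_zero, add_zero] using h0
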